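/- For graphs $H_1,H_2$, let $r(H_1,H_2)$ denote the Ramsey number: the smallest positive integer $N$ such that every graph $G$ on $N$ vertices contains $H_1$ as a (not necessarily induced) subgraph, or its complement $\overline{G}$ contains $H_2$ as a subgraph. Let $P_k$ be the path with $k$ vertices, and let $\Delta(G)$ be the maximum degree of $G$. Let $k\ge 2$ and $n\ge 3424k^4$ be integers, and let $T_n$ be a tree with $n$ vertices such that $\Delta(T_n)<n-k$. Then $$r(T_n,P_k)=n+\left\lfloor\frac{k}{2}\right\rfloor-1.$$ -/

import Mathlib

/-- The Ramsey number `r(H₁, H₂)`: the smallest positive integer `N` such that every graph `G` on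
`N` vertices contains `H₁` as a (not necessarily induced) subgraph, or its complement contains
`H₂` as a subgraph. -/
noncomputable def graphRamseyNumber {V W : Type*} (H₁ : SimpleGraph V) (H₂ : SimpleGraph W) : ℕ :=
  sInf {N : ℕ | 0 < N ∧ ∀ G : SimpleGraph (Fin N), H₁.IsContained G ∨ H₂.IsContained Gᶜ}

/-! Upper bound: put `d = k - 2`, `m = ⌊k/2⌋ - 1`, and let `H`, the complement of `G`, be a graph on
`n + m` vertices without a path on `k` vertices. Such an `H` is `d`-degenerate, so all but a small
fraction of its vertices have degree at most some `t = O(k)`. Keep back an independent set `Y` of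
vertices of `T` of degree at most two. Embed the rest of `T` greedily into low-degree vertices,
avoiding edges of `H`, and place `Y` by Hall's theorem (`isContained_compl_of_hall`). Hall's
condition can only fail at an unoccupied vertex `w` that is available to too few members of `Y`, and
the `m` spare vertices allow `m` such `w` to be discarded.

That `m` discards suffice is the content of `exists_small_trace`. If many pairs in a set `B` of
vertices of larger degree had private common neighbours, a path of `m + 1` vertices of `B` would
interleave with these connectors and extend at both ends to `2m + 3 ≥ k` vertices. Hence many
low-degree vertices see, inside `B`, only a fixed set `J` of at most `m` vertices, and `J` is
discarded.

The tree decides where this is applied. (1) Some `c` has `n/16` leaf neighbours: put `c` on a vertex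
`v` of degree at most `d`; all but `m` neighbours of `v` are occupied by vertices of `T` far from
`c`, which exist because the maximum degree is below `n - k`. (2) Two vertices have at least `2t`
leaves each: put them on vertices whose common neighbours lie in `J`. (3) Otherwise the leaves, or
else the vertices of degree at most two, are so spread out that no few vertices dominate almost all
of `Y`.

Lower bound: take disjoint cliques on `n - 1` and fewer than `⌊k/2⌋` vertices. -/

open SimpleGraph Finset


/-! ### Graphs without long paths are degenerate, hence sparse. -/

section PathsAndDegeneracy

open scoped Classical

/-- The finset of neighbours of `v`, with classical decidability. -/
noncomputable def nbrs {W : Type*} [Fintype W] (H : SimpleGraph W) (v : W) : Finset W :=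
  Finset.univ.filter (H.Adj v)

@[simp] theorem mem_nbrs {W : Type*} [Fintype W] {H : SimpleGraph W} {v w : W} :
    w ∈ nbrs H v ↔ H.Adj v w := by
  simp [nbrs]

/-- Every path of `H`, given by its list of vertices, has fewer than `k` vertices. -/
def PathsShorter {W : Type*} (H : SimpleGraph W) (k : ℕ) : Prop :=
  ∀ l : List W, l.Nodup → l.IsChain H.Adj → l.length < k

theorem pathsShorter_of_not_isContained {W : Type*} {H : SimpleGraph W} {k : ℕ}
    (h : ¬ (pathGraph k).IsContained H) : PathsShorter H k := by
  intro l hl hc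
  by_contra! hk
  apply h
  rw [List.isChain_iff_getElem] at hc
  refine ⟨⟨⟨fun i => l[i.1]'(by omega), ?_⟩, ?_⟩⟩
  · intro a b hab
    rw [pathGraph_adj] at hab
    rcases hab with hab | hab
    · have := hc a.1 (by omega)
      simpa [hab] using this
    · have := (hc b.1 (by omega)).symm
      simpa [hab] using this
  · intro a b hab
    have : l[a.1]'(by omega) = l[b.1]'(by omega) := hab
    rw [hl.getElem_inj_iff] at this
    exact Fin.ext this

theorem exists_chain_of_minDegree {W : Type*} [Fintype W] {Q : SimpleGraph W} {S : Finset W}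
    (hS : S.Nonempty) {j : ℕ} (h : ∀ v ∈ S, j ≤ (S ∩ nbrs Q v).card) :
    ∀ i ≤ j, ∃ l : List W, l.Nodup ∧ l.IsChain Q.Adj ∧ l.length = i + 1 ∧ ∀ x ∈ l, x ∈ S := by
  intro i
  induction i with
  | zero =>
    intro _
    obtain ⟨v, hv⟩ := hS
    exact ⟨[v], by simp, by simp, by simp, by simpa using hv⟩
  | succ i ih =>
    intro hi
    obtain ⟨l, hnd, hc, hlen, hl⟩ := ih (by omega)
    obtain ⟨b, l, rfl⟩ := List.exists_cons_of_length_eq_add_one hlen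
    have hb := h b (hl b (by simp))
    have : ∃ x ∈ S ∩ nbrs Q b, x ∉ l.toFinset := by
      apply Finset.exists_mem_notMem_of_card_lt_card
      have := l.toFinset_card_le
      simp at hlen
      omega
    obtain ⟨x, hx, hxl⟩ := this
    simp at hx hxl hnd
    refine ⟨x :: b :: l, ?_, ?_, by simpa using hlen, ?_⟩
    · have := hx.2.ne
      simp_all [eq_comm]
    · rw [List.isChain_cons_cons]
      exact ⟨hx.2.symm, hc⟩
    · intro y hy
      rw [List.mem_cons] at hy
      rcases hy with rfl | hy
      · exact hx.1
      · exact hl y hy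

/-- Repeatedly delete a vertex with fewer than `j` remaining neighbours; `ρ` records the deletion
time, so "later" neighbours are those still present. -/
theorem exists_degeneracy_order {W : Type*} [Fintype W] (Q : SimpleGraph W) (j : ℕ) (S : Finset W)
    (h : ∀ S' ⊆ S, S'.Nonempty → ∃ v ∈ S', (S' ∩ nbrs Q v).card < j) :
    ∃ ρ : W → ℕ, Set.InjOn ρ S ∧
      ∀ v ∈ S, (S.filter fun w => Q.Adj v w ∧ ρ v < ρ w).card < j := by
  induction S using Finset.strongInduction with
  | H S ih =>
    rcases S.eq_empty_or_nonempty with rfl | hne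
    · exact ⟨fun _ => 0, by simp, by simp⟩
    obtain ⟨v, hv, hvc⟩ := h S subset_rfl hne
    obtain ⟨ρ, hinj, hρ⟩ := ih (S.erase v) (Finset.erase_ssubset hv)
      fun S' hS' => h S' (hS'.trans (Finset.erase_subset _ _))
    refine ⟨fun w => if w = v then 0 else ρ w + 1, ?_, ?_⟩
    · intro a ha b hb hab
      by_cases hav : a = v <;> by_cases hbv : b = v <;> simp [hav, hbv] at hab ⊢
      exact hinj (by simp_all) (by simp_all) hab
    · intro w hw
      by_cases hwv : w = v
      · subst hwv
        refine lt_of_le_of_lt (Finset.card_le_card ?_) hvc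
        intro x; simp; tauto
      · refine lt_of_le_of_lt (Finset.card_le_card ?_) (hρ w (by simp [hwv, hw]))
        intro x
        simp only [mem_filter, mem_erase, hwv, if_false]
        rintro ⟨hx, hadj, hlt⟩
        by_cases hxv : x = v
        · simp [hxv] at hlt
        · simp [hxv] at hlt
          exact ⟨⟨hxv, hx⟩, hadj, hlt⟩

theorem PathsShorter.exists_card_inter_nbrs_lt {W : Type*} [Fintype W] {H : SimpleGraph W} {d : ℕ}
    (h : PathsShorter H (d + 2)) {S : Finset W} (hS : S.Nonempty) :
    ∃ v ∈ S, (S ∩ nbrs H v).card < d + 1 := by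
  by_contra! hcon
  obtain ⟨l, hnd, hc, hlen, -⟩ := exists_chain_of_minDegree hS hcon (d + 1) le_rfl
  have := h l hnd hc
  omega

theorem PathsShorter.exists_card_nbrs_le {W : Type*} [Fintype W] [Nonempty W] {H : SimpleGraph W}
    {d : ℕ} (h : PathsShorter H (d + 2)) : ∃ v, (nbrs H v).card ≤ d := by
  obtain ⟨v, -, hv⟩ := h.exists_card_inter_nbrs_lt (S := Finset.univ) Finset.univ_nonempty
  exact ⟨v, by simpa [Nat.lt_succ_iff] using hv⟩

/-- In a degeneracy order each edge is charged to its earlier end, which is charged at most `d`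
times. -/
theorem PathsShorter.sum_card_nbrs_le {W : Type*} [Fintype W] {H : SimpleGraph W} {d : ℕ}
    (h : PathsShorter H (d + 2)) :
    ∑ v, (nbrs H v).card ≤ 2 * d * Fintype.card W := by
  obtain ⟨ρ, hinj, hρ⟩ := exists_degeneracy_order H (d + 1) Finset.univ
    fun S' _ hS' => h.exists_card_inter_nbrs_lt hS'
  have h1 : ∑ v, (Finset.univ.filter fun w => H.Adj v w ∧ ρ v < ρ w).card ≤
      d * Fintype.card W := by
    calc _ ≤ ∑ _v : W, d := Finset.sum_le_sum fun v hv => Nat.lt_succ_iff.1 (hρ v hv)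
      _ = _ := by simp [mul_comm]
  have h2 : ∑ v, (Finset.univ.filter fun w => H.Adj v w ∧ ρ w < ρ v).card =
      ∑ v, (Finset.univ.filter fun w => H.Adj v w ∧ ρ v < ρ w).card := by
    simp only [Finset.card_filter]
    rw [Finset.sum_comm]
    simp only [H.adj_comm]
  have h3 : ∀ v, (nbrs H v).card = (Finset.univ.filter fun w => H.Adj v w ∧ ρ v < ρ w).card +
      (Finset.univ.filter fun w => H.Adj v w ∧ ρ w < ρ v).card := by
    intro v
    rw [← Finset.card_union_of_disjoint]
    · congr 1
      ext w
      simp only [mem_nbrs, mem_union, mem_filter, mem_univ, true_and]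
      constructor
      · intro hw
        rcases lt_trichotomy (ρ v) (ρ w) with h | h | h
        · exact Or.inl ⟨hw, h⟩
        · exact absurd (hinj (by simp) (by simp) h) hw.ne
        · exact Or.inr ⟨hw, h⟩
      · tauto
    · rw [Finset.disjoint_left]
      intro w
      simp
      omega
  rw [Finset.sum_congr rfl fun v _ => h3 v, Finset.sum_add_distrib, h2]
  linarith

theorem PathsShorter.card_mul_le {W : Type*} [Fintype W] {H : SimpleGraph W} {d : ℕ}
    (h : PathsShorter H (d + 2)) (s : ℕ) (B : Finset W) (hB : ∀ b ∈ B, s ≤ (nbrs H b).card) :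
    B.card * s ≤ 2 * d * Fintype.card W := by
  calc B.card * s = ∑ _b ∈ B, s := by simp
    _ ≤ ∑ b ∈ B, (nbrs H b).card := Finset.sum_le_sum hB
    _ ≤ ∑ b, (nbrs H b).card := Finset.sum_le_sum_of_subset (Finset.subset_univ _)
    _ ≤ _ := h.sum_card_nbrs_le

end PathsAndDegeneracy

/-! ### Controlling common neighbours by interleaved paths. -/

section CommonNeighbours

open scoped Classical

/-- A path `l` of `Q` whose edges `e` are replaced by pairwise different connecting vertices
`con e` becomes a path of `H`. -/
theorem exists_interleaved_chain {W : Type*} {H : SimpleGraph W} {B : Finset W}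
    {M : Finset (Sym2 W)} {con : Sym2 W → W} (hinj : Set.InjOn con M)
    (hB : ∀ e ∈ M, con e ∉ B) (hadj : ∀ e ∈ M, ∀ b ∈ e, H.Adj b (con e)) :
    ∀ (l : List W) (b : W), (b :: l).Nodup → (b :: l).IsChain (fun x y => s(x, y) ∈ M) →
      (∀ x ∈ b :: l, x ∈ B) →
      ∃ p : List W, (b :: p).Nodup ∧ (b :: p).IsChain H.Adj ∧ p.length = 2 * l.length ∧
        (b :: p).getLast (by simp) = (b :: l).getLast (by simp) ∧
        ∀ x ∈ p, x ∈ l ∨ ∃ e ∈ M, con e = x ∧ ∀ z ∈ e, z ∈ b :: l := by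
  intro l
  induction l with
  | nil => intro b _ _ _; exact ⟨[], by simp, by simp, by simp, by simp, by simp⟩
  | cons c l ih =>
    intro b hnd hc hmem
    rw [List.isChain_cons_cons] at hc
    obtain ⟨p, hp1, hp2, hp3, hp5, hp4⟩ := ih c (List.nodup_cons.1 hnd).2 hc.2
      fun x hx => hmem x (List.mem_cons_of_mem _ hx)
    have hM := hc.1
    have hbc : b ∉ c :: l := (List.nodup_cons.1 hnd).1
    have hx1 : con s(b, c) ∉ c :: p := by
      intro hx
      rcases List.mem_cons.1 hx with hx | hx
      · exact hB _ hM (by rw [hx]; exact hmem c (by simp))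
      · rcases hp4 _ hx with hx | ⟨e, he, hex, hez⟩
        · exact hB _ hM (hmem _ (by simp [hx]))
        · have : e = s(b, c) := hinj he hM hex
          subst this
          exact hbc (hez b (by simp))
    have hb1 : b ∉ c :: p := by
      intro hx
      rcases List.mem_cons.1 hx with hx | hx
      · exact hbc (by simp [hx])
      · rcases hp4 _ hx with hx | ⟨e, he, hex, hez⟩
        · exact hbc (by simp [hx])
        · exact hB _ he (hex ▸ hmem b (by simp))
    refine ⟨con s(b, c) :: c :: p, ?_, ?_, ?_, ?_, ?_⟩
    · rw [List.nodup_cons, List.nodup_cons]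
      refine ⟨?_, hx1, hp1⟩
      rw [List.mem_cons]
      rintro (hx | hx)
      · exact hB _ hM (hx ▸ hmem b (by simp))
      · exact hb1 hx
    · rw [List.isChain_cons_cons, List.isChain_cons_cons]
      exact ⟨hadj _ hM b (by simp), (hadj _ hM c (by simp)).symm, hp2⟩
    · simp [hp3]; ring
    · simpa using hp5
    · intro x hx
      rw [List.mem_cons, List.mem_cons] at hx
      rcases hx with rfl | rfl | hx
      · exact Or.inr ⟨_, hM, rfl, by simp⟩
      · simp
      · rcases hp4 _ hx with hx | ⟨e, he, hex, hez⟩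
        · exact Or.inl (by simp [hx])
        · exact Or.inr ⟨e, he, hex, fun z hz => List.mem_cons_of_mem _ (hez z hz)⟩

theorem exists_cons_chain {W : Type*} [Fintype W] {H : SimpleGraph W} {b : W} {p : List W}
    (hnd : (b :: p).Nodup) (hc : (b :: p).IsChain H.Adj) (hcard : p.length < (nbrs H b).card) :
    ∃ x, (x :: b :: p).Nodup ∧ (x :: b :: p).IsChain H.Adj := by
  have : ∃ x ∈ nbrs H b, x ∉ p.toFinset := by
    apply Finset.exists_mem_notMem_of_card_lt_card
    have := p.toFinset_card_le
    omega
  obtain ⟨x, hx, hxp⟩ := this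
  simp at hx hxp
  refine ⟨x, ?_, ?_⟩
  · rw [List.nodup_cons, List.mem_cons]
    exact ⟨by rintro (h | h); exacts [hx.ne h.symm, hxp h], hnd⟩
  · rw [List.isChain_cons_cons]
    exact ⟨hx.symm, hc⟩

/-- Interleaving `m + 1` vertices of `B` with `m` connectors gives a path of `H` on `2m + 1`
vertices with both ends in `B`. The degree bound lets each end be extended by one vertex, reaching
the forbidden `2m + 3`. -/
theorem chain_length_le_of_connectors {W : Type*} [Fintype W] {H : SimpleGraph W} {m : ℕ}
    (hH : PathsShorter H (2 * m + 3)) {B : Finset W}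
    (hdeg : ∀ b ∈ B, 2 * m + 4 ≤ (nbrs H b).card)
    {M : Finset (Sym2 W)} {con : Sym2 W → W} (hinj : Set.InjOn con M)
    (hB : ∀ e ∈ M, con e ∉ B) (hadj : ∀ e ∈ M, ∀ b ∈ e, H.Adj b (con e))
    (l : List W) (hnd : l.Nodup) (hc : l.IsChain (fun x y => s(x, y) ∈ M))
    (hl : ∀ x ∈ l, x ∈ B) : l.length ≠ m + 1 := by
  intro hlen
  have hne : l ≠ [] := by rintro rfl; simp at hlen
  obtain ⟨b, l, rfl⟩ := List.exists_cons_of_ne_nil hne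
  obtain ⟨p, hp1, hp2, hp3, hp5, -⟩ := exists_interleaved_chain hinj hB hadj l b hnd hc hl
  simp only [List.length_cons, add_left_inj] at hlen
  rw [hlen] at hp3
  obtain ⟨x, hx1, hx2⟩ := exists_cons_chain hp1 hp2 (by
    have := hdeg b (hl b (by simp)); omega)
  obtain ⟨q, z, hq⟩ : ∃ q z, x :: b :: p = q ++ [z] :=
    ⟨_, _, (List.dropLast_append_getLast (List.cons_ne_nil x (b :: p))).symm⟩
  have hz : z ∈ B := by
    have h1 : (x :: b :: p).getLast (by simp) = z := by simp [hq]
    rw [List.getLast_cons (by simp), hp5] at h1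
    rw [← h1]
    exact hl _ (List.getLast_mem _)
  have hqlen : q.length = 2 * m + 1 := by
    have := congrArg List.length hq
    simp at this
    omega
  have h1 : (z :: q.reverse).Nodup := by
    have : (q ++ [z]).reverse.Nodup := List.nodup_reverse.2 (hq ▸ hx1)
    simpa using this
  have h2 : (z :: q.reverse).IsChain H.Adj := by
    have : (q ++ [z]).reverse.IsChain H.Adj := by
      rw [List.isChain_reverse, ← hq]
      simpa only [H.adj_comm] using hx2
    simpa using this
  obtain ⟨y, hy1, hy2⟩ := exists_cons_chain h1 h2 (by
    have := hdeg z hz; simp; omega)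
  have := hH _ hy1 hy2
  simp at this
  omega

/-- Take a maximal set `M` of pairs in `B` having distinct common neighbours in `L`. As a graph on
`B` it has no path of `m + 1` vertices, so it is degenerate. The neighbourhood in `B` of an unused
`x ∈ L` is a clique of `M`, hence lies in its first vertex plus the fewer than `m` later neighbours
of that vertex. Pigeonholing over the first vertex gives `J` and `X`. -/
theorem exists_small_trace {W : Type*} [Fintype W] {H : SimpleGraph W} {m : ℕ}
    (hH : PathsShorter H (2 * m + 3)) (B L : Finset W) (hBL : Disjoint B L)
    (hdeg : ∀ b ∈ B, 2 * m + 4 ≤ (nbrs H b).card) :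
    ∃ J ⊆ B, ∃ X ⊆ L, J.card ≤ m ∧ (∀ x ∈ X, nbrs H x ∩ B ⊆ J) ∧
      L.card ≤ (X.card + m) * (B.card + 1) := by
  let good : Finset (Sym2 W) → Prop := fun M => ∃ con : Sym2 W → W, Set.InjOn con M ∧
    ∀ e ∈ M, con e ∈ L ∧ ¬ e.IsDiag ∧ ∀ b ∈ e, b ∈ B ∧ H.Adj b (con e)
  obtain ⟨M, hM, hmax⟩ := Finset.exists_max_image
    ((Finset.univ : Finset (Finset (Sym2 W))).filter good) Finset.card
    ⟨∅, by simp only [mem_filter, mem_univ, true_and]; exact ⟨fun e => e.out.1, by simp, by simp⟩⟩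
  simp only [mem_filter, mem_univ, true_and] at hM hmax
  obtain ⟨con, hinj, hcon⟩ := hM
  have hcB : ∀ e ∈ M, con e ∉ B := fun e he h =>
    Finset.disjoint_left.1 hBL h (hcon e he).1
  have hcadj : ∀ e ∈ M, ∀ b ∈ e, H.Adj b (con e) := fun e he b hb => ((hcon e he).2.2 b hb).2
  let Q : SimpleGraph W := SimpleGraph.fromEdgeSet (M : Set (Sym2 W))
  have hQ : ∀ a b, Q.Adj a b ↔ s(a, b) ∈ M := by
    intro a b
    simp only [Q, SimpleGraph.fromEdgeSet_adj, mem_coe]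
    exact ⟨fun h => h.1, fun h => ⟨h, by simpa using (hcon _ h).2.1⟩⟩
  obtain ⟨ρ, hρinj, hρ⟩ := exists_degeneracy_order Q m B (by
    intro S hS hne
    by_contra! hmin
    obtain ⟨l, hnd, hc, hlen, hl⟩ := exists_chain_of_minDegree hne hmin m le_rfl
    exact chain_length_le_of_connectors hH hdeg hinj hcB hcadj l hnd
      (by rwa [show (fun x y => s(x, y) ∈ M) = Q.Adj by ext; rw [hQ]]) (fun x hx => hS (hl x hx)) hlen)
  let later : W → Finset W := fun v => B.filter fun w => Q.Adj v w ∧ ρ v < ρ w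
  have hlater : ∀ v ∈ B, (later v).card < m := by
    intro v hv
    convert hρ v hv
  have hMcard : M.card ≤ m * B.card := by
    have hsub : M ⊆ B.biUnion fun v => (later v).image fun w => s(v, w) := by
      intro e he
      induction e using Sym2.ind with
      | h a b =>
        have ha := ((hcon _ he).2.2 a (by simp)).1
        have hb := ((hcon _ he).2.2 b (by simp)).1
        have hab : Q.Adj a b := (hQ a b).2 he
        simp only [mem_biUnion, mem_image]
        rcases lt_trichotomy (ρ a) (ρ b) with h | h | h
        · exact ⟨a, ha, b, by simp [later, hb, hab, h], rfl⟩
        · exact absurd (hρinj ha hb h) hab.ne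
        · exact ⟨b, hb, a, by simp [later, ha, hab.symm, h], Sym2.eq_swap⟩
    calc M.card ≤ _ := Finset.card_le_card hsub
      _ ≤ B.card * m := Finset.card_biUnion_le_card_mul _ _ _ fun v hv =>
        Finset.card_image_le.trans (hlater v hv).le
      _ = _ := mul_comm _ _
  -- Otherwise the pair could be added to `M` with `x` as its connector, against maximality.
  have hclique : ∀ x ∈ L, x ∉ M.image con → ∀ a ∈ nbrs H x ∩ B, ∀ b ∈ nbrs H x ∩ B, a ≠ b →
      Q.Adj a b := by
    intro x hx hxM a ha b hb hab
    rw [hQ]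
    by_contra he
    have hgood : good (insert s(a, b) M) := by
      have hup : ∀ e ∈ M, Function.update con s(a, b) x e = con e := fun e heM =>
        Function.update_of_ne (by rintro rfl; exact he heM) _ _
      refine ⟨Function.update con s(a, b) x, ?_, ?_⟩
      · intro e1 h1 e2 h2 h12
        rw [mem_coe, mem_insert] at h1 h2
        rcases h1 with rfl | h1 <;> rcases h2 with rfl | h2
        · rfl
        · rw [hup _ h2, Function.update_self] at h12
          exact absurd (mem_image.2 ⟨_, h2, h12.symm⟩) hxM
        · rw [hup _ h1, Function.update_self] at h12
          exact absurd (mem_image.2 ⟨_, h1, h12⟩) hxM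
        · rw [hup _ h1, hup _ h2] at h12
          exact hinj h1 h2 h12
      · intro e h1
        rw [mem_insert] at h1
        rcases h1 with rfl | h1
        · simp only [mem_inter, mem_nbrs] at ha hb
          simp only [Function.update_self, Sym2.mem_iff, Sym2.mk_isDiag_iff]
          refine ⟨hx, hab, ?_⟩
          rintro z (rfl | rfl)
          · exact ⟨ha.2, ha.1.symm⟩
          · exact ⟨hb.2, hb.1.symm⟩
        · rw [hup _ h1]
          exact hcon e h1
    have := hmax _ hgood
    rw [Finset.card_insert_of_notMem he] at this
    omega
  -- The index is the first neighbour of `x` in `B`; `none` serves the `x` without neighbours in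
  -- `B`.
  let J : Option W → Finset W := fun o => o.elim ∅ fun b => insert b (later b)
  let X : Option W → Finset W := fun o => L.filter fun x => nbrs H x ∩ B ⊆ J o
  let O : Finset (Option W) := insert none (B.image some)
  have hcover : L ⊆ M.image con ∪ O.biUnion X := by
    intro x hx
    by_cases hxM : x ∈ M.image con
    · exact mem_union_left _ hxM
    apply mem_union_right
    rw [mem_biUnion]
    rcases (nbrs H x ∩ B).eq_empty_or_nonempty with h | h
    · exact ⟨none, by simp [O], by simp [X, h, hx]⟩
    · obtain ⟨b, hb, hbmin⟩ := Finset.exists_min_image _ ρ h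
      refine ⟨some b, by simp [O]; exact (mem_inter.1 hb).2, ?_⟩
      refine mem_filter.2 ⟨hx, fun c hc => ?_⟩
      change c ∈ insert b (later b)
      by_cases hbc : c = b
      · simp [hbc]
      · have hadj := hclique x hx hxM b hb c hc (Ne.symm hbc)
        have hlt : ρ b < ρ c := lt_of_le_of_ne (hbmin c hc) fun h =>
          hbc (hρinj (mem_inter.1 hc).2 (mem_inter.1 hb).2 h.symm)
        simp [later, (mem_inter.1 hc).2, hadj, hlt]
  have hO : O.card ≤ B.card + 1 := by
    refine (Finset.card_insert_le _ _).trans ?_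
    have : (B.image some).card ≤ B.card := Finset.card_image_le
    omega
  obtain ⟨o, ho, homax⟩ := Finset.exists_max_image O (fun o => (X o).card) ⟨none, by simp [O]⟩
  refine ⟨J o, ?_, X o, Finset.filter_subset _ _, ?_, fun x hx => (mem_filter.1 hx).2, ?_⟩
  · rcases o with _ | b
    · simp [J]
    · have hb : b ∈ B := by simpa [O] using ho
      simp only [J, Option.elim]
      exact insert_subset hb (filter_subset _ _)
  · rcases o with _ | b
    · simp [J]
    · have hb : b ∈ B := by simpa [O] using ho
      exact (Finset.card_insert_le _ _).trans (hlater b hb)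
  · have h1 := Finset.card_le_card hcover
    have h2 := Finset.card_union_le (M.image con) (O.biUnion X)
    have h3 : (M.image con).card ≤ M.card := Finset.card_image_le
    have h4 : (O.biUnion X).card ≤ O.card * (X o).card :=
      Finset.card_biUnion_le_card_mul _ _ _ homax
    have h5 : O.card * (X o).card ≤ (B.card + 1) * (X o).card := Nat.mul_le_mul_right _ hO
    nlinarith

/-- A vertex `v` of small degree shares at most `m` neighbours, from a fixed set `J`, with each
vertex of a large set `X`. -/
theorem exists_small_common_nbrs {W : Type*} [Fintype W] {H : SimpleGraph W} {m t : ℕ}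
    (hH : PathsShorter H (2 * m + 3)) (v : W) (hv : (nbrs H v).card ≤ t) (L : Finset W) :
    ∃ J ⊆ nbrs H v, ∃ X ⊆ L, J.card ≤ m ∧ (∀ x ∈ X, nbrs H x ∩ nbrs H v ⊆ J) ∧
      v ∉ X ∧ Disjoint X (nbrs H v) ∧
      L.card ≤ (X.card + m) * (t + 1) + 1 + t * (2 * m + 4) := by
  let D₁ := (nbrs H v).filter fun b => 2 * m + 4 ≤ (nbrs H b).card
  let D₀ := (nbrs H v).filter fun b => ¬ 2 * m + 4 ≤ (nbrs H b).card
  -- Neighbours of `v` of degree below `2m + 4` cannot enter the path argument, but they have few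
  -- neighbours, so `X` simply avoids all of these.
  let bad : Finset W := insert v (nbrs H v ∪ D₀.biUnion (nbrs H))
  obtain ⟨J, hJ, X, hX, hJm, hXJ, hcard⟩ := exists_small_trace hH D₁ (L \ bad) (by
    rw [Finset.disjoint_left]
    intro b hb hb'
    have : b ∈ nbrs H v := (mem_filter.1 hb).1
    simp [bad, this] at hb') (fun b hb => (mem_filter.1 hb).2)
  have hXbad : ∀ x ∈ X, x ∉ bad := fun x hx => (mem_sdiff.1 (hX hx)).2
  refine ⟨J, hJ.trans (filter_subset _ _), X, hX.trans sdiff_subset, hJm, ?_, ?_, ?_, ?_⟩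
  · intro x hx b hb
    rw [mem_inter] at hb
    by_cases hd : 2 * m + 4 ≤ (nbrs H b).card
    · exact hXJ x hx (by simp only [mem_inter, hb.1, D₁, mem_filter, hb.2, hd, and_self])
    · exfalso
      apply hXbad x hx
      simp only [bad, mem_insert, mem_union, mem_biUnion]
      refine Or.inr (Or.inr ⟨b, mem_filter.2 ⟨hb.2, hd⟩, ?_⟩)
      simpa [H.adj_comm] using hb.1
  · intro h; exact hXbad v h (by simp [bad])
  · rw [Finset.disjoint_left]
    intro x hx hxv
    exact hXbad x hx (mem_insert_of_mem (mem_union_left _ hxv))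
  · have h1 : L.card ≤ (L \ bad).card + bad.card := by
      have := Finset.le_card_sdiff bad L
      omega
    have h2 : bad.card ≤ (nbrs H v ∪ D₀.biUnion (nbrs H)).card + 1 := Finset.card_insert_le _ _
    have h3 : (nbrs H v ∪ D₀.biUnion (nbrs H)).card ≤ D₁.card + D₀.card + D₀.card * (2 * m + 3) := by
      refine (Finset.card_union_le _ _).trans (add_le_add ?_ ?_)
      · rw [Finset.card_filter_add_card_filter_not]
      · exact Finset.card_biUnion_le_card_mul _ _ _ fun b hb => by
          have := (mem_filter.1 hb).2
          omega
    have h4 : D₁.card + D₀.card ≤ t := by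
      rwa [Finset.card_filter_add_card_filter_not]
    have h5 : (X.card + m) * (D₁.card + 1) ≤ (X.card + m) * (t + 1) :=
      Nat.mul_le_mul_left _ (by omega)
    have h6 : D₀.card * (2 * m + 3) ≤ t * (2 * m + 3) := Nat.mul_le_mul_right _ (by omega)
    have h7 : t * (2 * m + 4) = t * (2 * m + 3) + t := by ring
    omega

end CommonNeighbours


/-! ### Trees: greedy embedding, completion by Hall's theorem, and low-degree vertices. -/

section TreeFacts

open scoped Classical

/-- With the tree rooted at `c`, the only neighbour of `u` that is not farther from the root is its
parent, by uniqueness of paths. -/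
theorem SimpleGraph.IsTree.eq_of_adj_of_dist_le {V : Type*} {T : SimpleGraph V} (hT : T.IsTree)
    (c : V) {u w w' : V} (hw : T.Adj u w) (hw' : T.Adj u w') (h : T.dist c w ≤ T.dist c u)
    (h' : T.dist c w' ≤ T.dist c u) : w = w' := by
  have key : ∀ x, T.Adj u x → T.dist c x ≤ T.dist c u →
      ∃ p : T.Walk c u, p.IsPath ∧ p.penultimate = x := by
    intro x hx hle
    have hlt : T.dist c u = T.dist c x + 1 := by
      rcases hT.dist_eq_dist_add_one_of_adj c hx with h | h <;> omega
    obtain ⟨p, hp⟩ := hT.connected.exists_walk_length_eq_dist c x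
    refine ⟨p.concat hx.symm, ?_, by simp⟩
    apply Walk.isPath_of_length_eq_dist
    simp [hp, hlt]
  obtain ⟨p, hp, rfl⟩ := key w hw h
  obtain ⟨q, hq, rfl⟩ := key w' hw' h'
  rw [(hT.existsUnique_path c u).unique hp hq]

theorem SimpleGraph.IsTree.exists_card_inter_nbrs_le_one {V : Type*} [Fintype V]
    {T : SimpleGraph V} (hT : T.IsTree) {Z : Finset V} (hZ : Z.Nonempty) :
    ∃ z ∈ Z, (Z ∩ nbrs T z).card ≤ 1 := by
  obtain ⟨c, hc⟩ := hZ
  obtain ⟨z, hz, hmax⟩ := Finset.exists_max_image Z (T.dist c) ⟨c, hc⟩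
  refine ⟨z, hz, Finset.card_le_one.2 ?_⟩
  intro a ha b hb
  simp only [mem_inter, mem_nbrs] at ha hb
  exact hT.eq_of_adj_of_dist_le c ha.2 hb.2 (hmax a ha.1) (hmax b hb.1)

theorem SimpleGraph.IsTree.sum_card_nbrs {V : Type*} [Fintype V] {T : SimpleGraph V}
    (hT : T.IsTree) : ∑ v, (nbrs T v).card + 2 = 2 * Fintype.card V := by
  have h1 := T.sum_degrees_eq_twice_card_edges
  have h2 := hT.card_edgeFinset
  have h3 : ∀ v, T.degree v = (nbrs T v).card := by
    intro v
    rw [← SimpleGraph.card_neighborFinset_eq_degree]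
    congr 1
    ext; simp
  simp only [h3] at h1
  rw [h1, ← h2]
  ring

theorem SimpleGraph.IsTree.nbrs_nonempty {V : Type*} [Fintype V] {T : SimpleGraph V}
    (hT : T.IsTree) (hV : 2 ≤ Fintype.card V) (v : V) : (nbrs T v).Nonempty := by
  have : Nontrivial V := Fintype.one_lt_card_iff_nontrivial.1 hV
  obtain ⟨w, hw⟩ := hT.connected.preconnected.exists_adj_of_nontrivial v
  exact ⟨w, by simpa using hw⟩

/-- Greedy embedding of an induced subforest of `T` into the complement of `H`, vertex by vertex,
where `z` has to be placed in the list `Λ z` of vertices of small `H`-degree. -/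
theorem SimpleGraph.IsTree.exists_greedy_embedding {V W : Type*} [Fintype V] [Fintype W]
    [Nonempty W] {T : SimpleGraph V} (hT : T.IsTree) (H : SimpleGraph W) (t : ℕ)
    (Λ : V → Finset W) (Z : Finset V)
    (hdeg : ∀ z ∈ Z, ∀ x ∈ Λ z, (nbrs H x).card ≤ t)
    (hcard : ∀ z ∈ Z, t + (Z.filter fun z' => ¬ Disjoint (Λ z) (Λ z')).card < (Λ z).card) :
    ∃ f : V → W, (∀ z ∈ Z, f z ∈ Λ z) ∧ Set.InjOn f Z ∧
      ∀ a ∈ Z, ∀ b ∈ Z, T.Adj a b → ¬ H.Adj (f a) (f b) := by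
  induction Z using Finset.strongInduction with
  | H Z ih =>
    rcases Z.eq_empty_or_nonempty with rfl | hne
    · exact ⟨fun _ => Classical.arbitrary W, by simp, by simp, by simp⟩
    obtain ⟨z, hz, hz1⟩ := hT.exists_card_inter_nbrs_le_one hne
    obtain ⟨f, hf1, hf2, hf3⟩ := ih (Z.erase z) (Finset.erase_ssubset hz)
      (fun z' hz' => hdeg z' (mem_of_mem_erase hz')) (fun z' hz' =>
        lt_of_le_of_lt (Nat.add_le_add_left (Finset.card_le_card
          (Finset.filter_subset_filter _ (Finset.erase_subset _ _))) _)
          (hcard z' (mem_of_mem_erase hz')))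
    let used := ((Z.erase z).filter fun z' => ¬ Disjoint (Λ z) (Λ z')).image f
    -- Since `z` is placed last and has at most one neighbour in `Z`, only `t` vertices are
    -- forbidden by adjacency.
    let forb := (Z ∩ nbrs T z).biUnion fun z' => nbrs H (f z')
    have hforb : forb.card ≤ t := by
      calc forb.card ≤ (Z ∩ nbrs T z).card * t := by
            apply Finset.card_biUnion_le_card_mul
            intro z' hz'
            simp only [mem_inter, mem_nbrs] at hz'
            exact hdeg z' hz'.1 _ (hf1 z' (mem_erase.2 ⟨hz'.2.ne', hz'.1⟩))
        _ ≤ 1 * t := Nat.mul_le_mul_right _ hz1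
        _ = t := one_mul t
    have hused : used.card ≤ (Z.filter fun z' => ¬ Disjoint (Λ z) (Λ z')).card :=
      Finset.card_image_le.trans (Finset.card_le_card
        (Finset.filter_subset_filter _ (Finset.erase_subset _ _)))
    obtain ⟨x, hx, hxn⟩ : ∃ x ∈ Λ z, x ∉ forb ∪ used := by
      apply Finset.exists_mem_notMem_of_card_lt_card
      have := Finset.card_union_le forb used
      have := hcard z hz
      omega
    rw [mem_union, not_or] at hxn
    have hup : ∀ a, a ≠ z → Function.update f z x a = f a := fun a ha =>
      Function.update_of_ne ha _ _
    have hfx : ∀ a ∈ Z, a ≠ z → f a ≠ x := by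
      intro a ha haz hax
      apply hxn.2
      have haZ : a ∈ Z.erase z := mem_erase.2 ⟨haz, ha⟩
      refine mem_image.2 ⟨a, mem_filter.2 ⟨haZ, ?_⟩, hax⟩
      rw [Finset.not_disjoint_iff]
      exact ⟨x, hx, hax ▸ hf1 a haZ⟩
    have hadj : ∀ a ∈ Z, T.Adj z a → ¬ H.Adj x (f a) := by
      intro a ha hza hxa
      exact hxn.1 (mem_biUnion.2 ⟨a, by simp [ha, hza], by simpa using hxa.symm⟩)
    refine ⟨Function.update f z x, ?_, ?_, ?_⟩
    · intro a ha
      by_cases haz : a = z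
      · subst haz; simpa using hx
      · rw [hup a haz]; exact hf1 a (mem_erase.2 ⟨haz, ha⟩)
    · intro a ha b hb hab
      by_cases haz : a = z <;> by_cases hbz : b = z
      · rw [haz, hbz]
      · subst haz
        rw [Function.update_self, hup b hbz] at hab
        exact absurd hab.symm (hfx b hb hbz)
      · subst hbz
        rw [Function.update_self, hup a haz] at hab
        exact absurd hab (hfx a ha haz)
      · rw [hup a haz, hup b hbz] at hab
        exact hf2 (by simpa [haz] using ha) (by simpa [hbz] using hb) hab
    · intro a ha b hb hab
      by_cases haz : a = z
      · subst haz
        rw [Function.update_self, hup b hab.ne']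
        exact hadj b hb hab
      · by_cases hbz : b = z
        · subst hbz
          rw [Function.update_self, hup a haz]
          exact fun h => hadj a ha hab.symm h.symm
        · rw [hup a haz, hup b hbz]
          exact hf3 a (mem_erase.2 ⟨haz, ha⟩) b (mem_erase.2 ⟨hbz, hb⟩) hab

/-- An embedding of `T - Y` extends to `T` by Hall's theorem, if the vertices of `Y` have degree at
most two and every vertex outside the image is available for enough vertices of `Y`. -/
theorem isContained_compl_of_hall {V W : Type*} [Fintype V] [Fintype W]
    {T : SimpleGraph V} {H : SimpleGraph W} {t : ℕ} {Y : Finset V} {R : Finset W} {f : V → W}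
    (hYind : ∀ a ∈ Y, ∀ b ∈ Y, ¬ T.Adj a b) (hYdeg : ∀ y ∈ Y, (nbrs T y).card ≤ 2)
    (hinj : Set.InjOn f (Y : Set V)ᶜ)
    (hadj : ∀ a ∉ Y, ∀ b ∉ Y, T.Adj a b → ¬ H.Adj (f a) (f b))
    (hdeg : ∀ y ∈ Y, ∀ q, T.Adj y q → (nbrs H (f q)).card ≤ t)
    (hR : ∀ a ∉ Y, f a ∉ R) (hcard : Y.card ≤ R.card)
    (hav : ∀ w ∈ R, 2 * t ≤ (Y.filter fun y => ∀ q, T.Adj y q → ¬ H.Adj (f q) w).card) :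
    T.IsContained Hᶜ := by
  obtain ⟨R', hR', hcard'⟩ := Finset.exists_subset_card_eq hcard
  let av : Y → Finset W := fun y => R'.filter fun w => ∀ q, T.Adj y.1 q → ¬ H.Adj (f q) w
  have hmiss : ∀ y : Y, R'.card ≤ (av y).card + 2 * t := by
    intro y
    have h1 : R' ⊆ av y ∪ (nbrs T y.1).biUnion fun q => nbrs H (f q) := by
      intro w hw
      by_cases h : ∀ q, T.Adj y.1 q → ¬ H.Adj (f q) w
      · exact mem_union_left _ (mem_filter.2 ⟨hw, h⟩)
      · push Not at h
        obtain ⟨q, hq1, hq2⟩ := h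
        exact mem_union_right _ (mem_biUnion.2 ⟨q, by simpa using hq1, by simpa using hq2⟩)
    refine (Finset.card_le_card h1).trans ((Finset.card_union_le _ _).trans ?_)
    gcongr
    refine (Finset.card_biUnion_le_card_mul _ _ t fun q hq =>
      hdeg y.1 y.2 q (by simpa using hq)).trans ?_
    exact Nat.mul_le_mul_right _ (hYdeg _ y.2)
  have hall : ∀ S : Finset Y, S.card ≤ (S.biUnion av).card := by
    intro S
    rcases S.eq_empty_or_nonempty with rfl | ⟨y, hy⟩
    · simp
    have h1 : (av y).card ≤ (S.biUnion av).card :=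
      Finset.card_le_card (Finset.subset_biUnion_of_mem av hy)
    have h2 := hmiss y
    -- A single `y` misses at most `2t` vertices of `R'`, which settles small `S`. A larger `S`
    -- omits fewer than `2t` members of `Y`, so it contains a candidate for every `w`.
    by_cases hS : S.card + 2 * t ≤ Y.card
    · omega
    have hSY : S.card ≤ Y.card := by simpa using Finset.card_le_univ S
    have : R' ⊆ S.biUnion av := by
      intro w hw
      by_contra hcon
      have hsub : (Y.filter fun y => ∀ q, T.Adj y q → ¬ H.Adj (f q) w) ⊆
          Y \ S.image Subtype.val := by
        intro y hy
        rw [mem_filter] at hy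
        refine mem_sdiff.2 ⟨hy.1, fun hyS => hcon ?_⟩
        obtain ⟨y', hy', rfl⟩ := mem_image.1 hyS
        exact mem_biUnion.2 ⟨y', hy', mem_filter.2 ⟨hw, hy.2⟩⟩
      have h3 := Finset.card_le_card hsub
      have h4 : (Y \ S.image Subtype.val).card = Y.card - S.card := by
        rw [Finset.card_sdiff_of_subset, Finset.card_image_of_injective _ Subtype.val_injective]
        intro y hy
        obtain ⟨y', hy', rfl⟩ := mem_image.1 hy
        exact y'.2
      have := hav w (hR' hw)
      omega
    have := Finset.card_le_card this
    omega
  obtain ⟨g, hginj, hg⟩ := (Finset.all_card_le_biUnion_card_iff_exists_injective av).1 hall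
  let F : V → W := fun a => if h : a ∈ Y then g ⟨a, h⟩ else f a
  have hFY : ∀ a (h : a ∈ Y), F a = g ⟨a, h⟩ := fun a h => dif_pos h
  have hFn : ∀ a, a ∉ Y → F a = f a := fun a h => dif_neg h
  have hgR : ∀ y, g y ∈ R := fun y => hR' (mem_filter.1 (hg y)).1
  have hF : Function.Injective F := by
    intro a b hab
    by_cases ha : a ∈ Y <;> by_cases hb : b ∈ Y
    · rw [hFY a ha, hFY b hb] at hab
      exact congrArg Subtype.val (hginj hab)
    · rw [hFY a ha, hFn b hb] at hab
      exact absurd (hab ▸ hgR ⟨a, ha⟩) (hR b hb)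
    · rw [hFn a ha, hFY b hb] at hab
      exact absurd (hab ▸ hgR ⟨b, hb⟩) (hR a ha)
    · rw [hFn a ha, hFn b hb] at hab
      exact hinj ha hb hab
  refine ⟨⟨⟨F, ?_⟩, hF⟩⟩
  intro a b hab
  rw [SimpleGraph.compl_adj]
  refine ⟨fun h => hab.ne (hF h), ?_⟩
  by_cases ha : a ∈ Y <;> by_cases hb : b ∈ Y
  · exact absurd hab (hYind a ha b hb)
  · rw [hFY a ha, hFn b hb, H.adj_comm]
    exact (mem_filter.1 (hg ⟨a, ha⟩)).2 b hab
  · rw [hFn a ha, hFY b hb]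
    exact (mem_filter.1 (hg ⟨b, hb⟩)).2 a hab.symm
  · rw [hFn a ha, hFn b hb]
    exact hadj a ha b hb hab

/-- An independent set extends to one that is maximal inside `S`. -/
theorem exists_large_independent {V : Type*} [Fintype V] (Γ : SimpleGraph V) (D : ℕ)
    (S I₀ : Finset V) (hI₀ : I₀ ⊆ S) (hind : ∀ a ∈ I₀, ∀ b ∈ I₀, ¬ Γ.Adj a b)
    (hD : ∀ i ∈ S, (S ∩ nbrs Γ i).card ≤ D) :
    ∃ I, I₀ ⊆ I ∧ I ⊆ S ∧ (∀ a ∈ I, ∀ b ∈ I, ¬ Γ.Adj a b) ∧ S.card ≤ (D + 1) * I.card := by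
  obtain ⟨I, hI, hmax⟩ := Finset.exists_max_image
    (S.powerset.filter fun I => I₀ ⊆ I ∧ ∀ a ∈ I, ∀ b ∈ I, ¬ Γ.Adj a b) Finset.card
    ⟨I₀, by simp only [mem_filter, mem_powerset]; exact ⟨hI₀, subset_rfl, hind⟩⟩
  simp only [mem_filter, mem_powerset] at hI hmax
  obtain ⟨hIS, hI0, hIind⟩ := hI
  refine ⟨I, hI0, hIS, hIind, ?_⟩
  have hcov : S ⊆ I.biUnion fun i => insert i (S ∩ nbrs Γ i) := by
    intro s hs
    by_contra hcon
    simp only [mem_biUnion, mem_insert, mem_inter, mem_nbrs, not_exists, not_and, not_or] at hcon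
    have hsI : s ∉ I := fun h => (hcon s h).1 rfl
    have hsadj : ∀ i ∈ I, ¬ Γ.Adj i s := fun i hi => (hcon i hi).2 hs
    have := hmax (insert s I) ⟨insert_subset hs hIS, hI0.trans (subset_insert _ _), by
      intro a ha b hb
      rw [mem_insert] at ha hb
      rcases ha with rfl | ha <;> rcases hb with rfl | hb
      · exact Γ.loopless.irrefl _
      · exact fun h => hsadj b hb h.symm
      · exact hsadj a ha
      · exact hIind a ha b hb⟩
    rw [Finset.card_insert_of_notMem hsI] at this
    omega
  refine (Finset.card_le_card hcov).trans ?_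
  rw [mul_comm]
  apply Finset.card_biUnion_le_card_mul
  intro i hi
  exact (Finset.card_insert_le _ _).trans (Nat.succ_le_succ (hD i (hIS hi)))

/-- The leaves of `T`. -/
noncomputable def leaves {V : Type*} [Fintype V] (T : SimpleGraph V) : Finset V :=
  Finset.univ.filter fun v => (nbrs T v).card = 1

theorem mem_leaves {V : Type*} [Fintype V] {T : SimpleGraph V} {v : V} :
    v ∈ leaves T ↔ (nbrs T v).card = 1 := by
  simp [leaves]

theorem eq_of_adj_of_mem_leaves {V : Type*} [Fintype V] {T : SimpleGraph V} {u a b : V}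
    (hu : u ∈ leaves T) (ha : T.Adj u a) (hb : T.Adj u b) : a = b :=
  Finset.card_le_one.1 (mem_leaves.1 hu).le a (by simpa using ha) b (by simpa using hb)

theorem SimpleGraph.IsTree.not_adj_leaves {V : Type*} [Fintype V] {T : SimpleGraph V}
    (hT : T.IsTree) (hV : 3 ≤ Fintype.card V) {a b : V} (ha : a ∈ leaves T) (hb : b ∈ leaves T) :
    ¬ T.Adj a b := by
  intro hab
  obtain ⟨c, hc⟩ : ∃ c, c ∉ ({a, b} : Finset V) := by
    by_contra! h
    have h1 : (Finset.univ : Finset V) ⊆ {a, b} := fun x _ => h x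
    have := Finset.card_le_card h1
    have := Finset.card_le_two (a := a) (b := b)
    simp at *
    omega
  have hclosed : ∀ x y, T.Reachable x y → x ∈ ({a, b} : Set V) → y ∈ ({a, b} : Set V) := by
    rintro x y ⟨p⟩
    induction p with
    | nil => exact id
    | cons h p ih =>
      rintro (rfl | rfl)
      · exact ih (Or.inr (eq_of_adj_of_mem_leaves ha h hab))
      · exact ih (Or.inl (eq_of_adj_of_mem_leaves hb h hab.symm))
  have := hclosed a c (hT.connected a c) (Or.inl rfl)
  simp at hc this
  tauto

/-- The sum of `deg - 2` over a tree is `-2`, and only leaves contribute negatively. -/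
theorem SimpleGraph.IsTree.sum_high_le {V : Type*} [Fintype V] {T : SimpleGraph V}
    (hT : T.IsTree) (hV : 2 ≤ Fintype.card V) :
    ∑ v ∈ Finset.univ.filter (fun v => 3 ≤ (nbrs T v).card), ((nbrs T v).card - 2) ≤
      (leaves T).card := by
  have h1 := hT.sum_card_nbrs
  have h2 : ∀ v, (nbrs T v).card + (if (nbrs T v).card = 1 then 1 else 0) =
      2 + if 3 ≤ (nbrs T v).card then (nbrs T v).card - 2 else 0 := by
    intro v
    have := (hT.nbrs_nonempty hV v).card_pos
    split_ifs <;> omega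
  have h3 := Finset.sum_congr (rfl : (Finset.univ : Finset V) = _) fun v _ => h2 v
  rw [Finset.sum_add_distrib, Finset.sum_add_distrib] at h3
  rw [leaves, Finset.card_filter, Finset.sum_filter]
  simp at h3 ⊢
  omega

theorem SimpleGraph.IsTree.card_le_two_mul_low {V : Type*} [Fintype V] {T : SimpleGraph V}
    (hT : T.IsTree) (hV : 2 ≤ Fintype.card V) :
    Fintype.card V ≤ 2 * (Finset.univ.filter fun v => (nbrs T v).card ≤ 2).card := by
  have h1 := hT.sum_high_le hV
  have h2 : (Finset.univ.filter (fun v => 3 ≤ (nbrs T v).card)).card ≤ (leaves T).card := by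
    refine le_trans ?_ h1
    rw [Finset.card_eq_sum_ones]
    refine Finset.sum_le_sum fun v hv => ?_
    have := (mem_filter.1 hv).2
    omega
  have h3 : (leaves T).card ≤ (Finset.univ.filter fun v => (nbrs T v).card ≤ 2).card := by
    refine Finset.card_le_card fun v hv => ?_
    rw [mem_leaves] at hv
    simp [hv]
  have h4 := Finset.card_filter_add_card_filter_not (s := (Finset.univ : Finset V))
    (fun v => (nbrs T v).card ≤ 2)
  have h5 : (Finset.univ.filter fun v => ¬ (nbrs T v).card ≤ 2) =
      Finset.univ.filter (fun v => 3 ≤ (nbrs T v).card) := by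
    ext v; simp; omega
  rw [h5, Finset.card_univ] at h4
  omega

/-- At least half of the vertices have degree at most two, and a maximal independent set among them
contains at least a third of those. -/
theorem SimpleGraph.IsTree.exists_independent_low {V : Type*} [Fintype V] {T : SimpleGraph V}
    (hT : T.IsTree) (hV : 2 ≤ Fintype.card V) (Y₀ : Finset V)
    (hind : ∀ a ∈ Y₀, ∀ b ∈ Y₀, ¬ T.Adj a b) (hdeg : ∀ a ∈ Y₀, (nbrs T a).card ≤ 2) :
    ∃ Y, Y₀ ⊆ Y ∧ (∀ a ∈ Y, ∀ b ∈ Y, ¬ T.Adj a b) ∧ (∀ a ∈ Y, (nbrs T a).card ≤ 2) ∧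
      Fintype.card V ≤ 6 * Y.card := by
  obtain ⟨Y, h1, h2, h3, h4⟩ := exists_large_independent T 2
    (Finset.univ.filter fun v => (nbrs T v).card ≤ 2) Y₀ (fun a ha => by simpa using hdeg a ha)
    hind (fun i hi => (Finset.card_le_card inter_subset_right).trans (by simpa using hi))
  refine ⟨Y, h1, h3, fun a ha => by simpa using h2 ha, ?_⟩
  have := hT.card_le_two_mul_low hV
  omega

/-- A tree with few leaves has many vertices of degree at most two with pairwise disjoint closed
neighbourhoods. -/
theorem SimpleGraph.IsTree.exists_scattered_low {V : Type*} [Fintype V] {T : SimpleGraph V}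
    (hT : T.IsTree) (hV : 2 ≤ Fintype.card V) :
    ∃ Y : Finset V, (∀ a ∈ Y, ∀ b ∈ Y, ¬ T.Adj a b) ∧ (∀ a ∈ Y, (nbrs T a).card ≤ 2) ∧
      (∀ a ∈ Y, ∀ b ∈ Y, a ≠ b → Disjoint (nbrs T a) (nbrs T b)) ∧
      Fintype.card V ≤ 4 * (leaves T).card + 7 * Y.card := by
  let hi : Finset V := Finset.univ.filter (fun v => 3 ≤ (nbrs T v).card)
  let S : Finset V := Finset.univ \ hi.biUnion fun v => insert v (nbrs T v)
  have hS : ∀ s ∈ S, (nbrs T s).card ≤ 2 ∧ ∀ q, T.Adj s q → (nbrs T q).card ≤ 2 := by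
    intro s hs
    simp only [S, mem_sdiff, mem_univ, true_and, mem_biUnion, hi, mem_filter, mem_insert, mem_nbrs,
      not_exists, not_and, not_or] at hs
    constructor
    · by_contra! h
      exact (hs s h).1 rfl
    · intro q hq
      by_contra! h
      exact (hs q h).2 hq.symm
  have hScard : Fintype.card V ≤ 4 * (leaves T).card + S.card := by
    -- A closed neighbourhood has `deg + 1 ≤ 4 (deg - 2)` vertices once `deg ≥ 3`.
    have h1 : (hi.biUnion fun v => insert v (nbrs T v)).card ≤ 4 * (leaves T).card := by
      refine Finset.card_biUnion_le.trans ?_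
      refine le_trans ?_ (Nat.mul_le_mul_left 4 (hT.sum_high_le hV))
      rw [Finset.mul_sum]
      refine Finset.sum_le_sum fun v hv => ?_
      have := (mem_filter.1 hv).2
      have := Finset.card_insert_le v (nbrs T v)
      omega
    have h2 := Finset.le_card_sdiff (hi.biUnion fun v => insert v (nbrs T v)) Finset.univ
    rw [Finset.card_univ] at h2
    change _ ≤ S.card at h2
    omega
  -- `Γ` joins vertices at distance one or two. On `S` its degrees are at most `2 + 2 * 2 = 6`,
  -- whence the factor `7`.
  let Γ : SimpleGraph V := SimpleGraph.fromRel fun a b => T.Adj a b ∨ ∃ q, T.Adj a q ∧ T.Adj b q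
  have hΓ : ∀ a b, Γ.Adj a b ↔ a ≠ b ∧ (T.Adj a b ∨ ∃ q, T.Adj a q ∧ T.Adj b q) := by
    intro a b
    simp only [Γ, SimpleGraph.fromRel_adj, T.adj_comm b a, and_comm (a := T.Adj b _), or_self]
  obtain ⟨Y, -, hYS, hY, hcard⟩ := exists_large_independent Γ 6 S ∅ (by simp) (by simp) (by
    intro s hs
    have hsub : S ∩ nbrs Γ s ⊆ nbrs T s ∪ (nbrs T s).biUnion (nbrs T) := by
      intro x hx
      simp only [mem_inter, mem_nbrs, hΓ] at hx
      simp only [mem_union, mem_biUnion, mem_nbrs]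
      rcases hx.2.2 with h | ⟨q, h1, h2⟩
      · exact Or.inl h
      · exact Or.inr ⟨q, h1, h2.symm⟩
    have h1 := Finset.card_le_card hsub
    have h2 := Finset.card_union_le (nbrs T s) ((nbrs T s).biUnion (nbrs T))
    have h3 := Finset.card_biUnion_le_card_mul (nbrs T s) (nbrs T) 2 fun q hq =>
      (hS s hs).2 q (by simpa using hq)
    have h4 := (hS s hs).1
    omega)
  refine ⟨Y, ?_, fun a ha => (hS a (hYS ha)).1, ?_, by omega⟩
  · intro a ha b hb hab
    exact hY a ha b hb ((hΓ a b).2 ⟨hab.ne, Or.inl hab⟩)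
  · intro a ha b hb hab
    rw [Finset.disjoint_left]
    intro q hq1 hq2
    exact hY a ha b hb ((hΓ a b).2 ⟨hab, Or.inr ⟨q, by simpa using hq1, by simpa using hq2⟩⟩)

end TreeFacts


/-! ### Trees with a vertex adjacent to many leaves. -/

section LargeStar

open scoped Classical

theorem PathsShorter.mono {W : Type*} {H : SimpleGraph W} {k l : ℕ} (h : PathsShorter H k)
    (hkl : k ≤ l) : PathsShorter H l :=
  fun p h1 h2 => (h p h1 h2).trans_le hkl

/-- The vertices of degree at most `t`. -/
noncomputable def lowVerts {W : Type*} [Fintype W] (H : SimpleGraph W) (t : ℕ) : Finset W :=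
  Finset.univ.filter fun v => (nbrs H v).card ≤ t

@[simp] theorem mem_lowVerts {W : Type*} [Fintype W] {H : SimpleGraph W} {t : ℕ} {v : W} :
    v ∈ lowVerts H t ↔ (nbrs H v).card ≤ t := by
  simp [lowVerts]

theorem PathsShorter.card_le_card_lowVerts_add {W : Type*} [Fintype W] {H : SimpleGraph W}
    {d a t : ℕ} (h : PathsShorter H (d + 2)) (hat : 2 * a * d ≤ t) :
    a * Fintype.card W ≤ a * (lowVerts H t).card + Fintype.card W := by
  have h1 := h.card_mul_le (t + 1) (Finset.univ \ lowVerts H t) (by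
    intro b hb
    simp at hb
    omega)
  have h2 := Finset.le_card_sdiff (lowVerts H t) Finset.univ
  rw [Finset.card_univ] at h2
  set x := (Finset.univ \ lowVerts H t).card
  have h3 : a * x ≤ Fintype.card W := by
    rcases Nat.eq_zero_or_pos d with rfl | hd
    · have : x = 0 := by
        by_contra hx
        have : 0 < x * (t + 1) := by positivity
        omega
      simp [this]
    · have : d * (a * x) ≤ d * Fintype.card W := by nlinarith
      exact Nat.le_of_mul_le_mul_left this hd
  have h4 : a * Fintype.card W ≤ a * ((lowVerts H t).card + x) := Nat.mul_le_mul_left _ (by omega)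
  rw [mul_add] at h4
  omega

theorem exists_top_subset {V : Type*} (f : V → ℕ) (S : Finset V) (j : ℕ) (hj : j ≤ S.card) :
    ∃ U ⊆ S, U.card = j ∧ ∀ u ∈ U, ∀ s ∈ S, s ∉ U → f s ≤ f u := by
  induction j with
  | zero => exact ⟨∅, by simp, by simp, by simp⟩
  | succ j ih =>
    obtain ⟨U, hU, hUc, htop⟩ := ih (by omega)
    obtain ⟨x, hx, hmax⟩ := Finset.exists_max_image (S \ U) f (by
      rw [← Finset.card_pos, Finset.card_sdiff_of_subset hU]; omega)
    rw [mem_sdiff] at hx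
    refine ⟨insert x U, insert_subset hx.1 hU, by
      rw [Finset.card_insert_of_notMem hx.2, hUc], ?_⟩
    intro u hu s hs hsU
    rw [mem_insert, not_or] at hsU
    rcases mem_insert.1 hu with rfl | hu
    · exact hmax s (mem_sdiff.2 ⟨hs, hsU.2⟩)
    · exact htop u hu s hs hsU.2

/-- Far from `c` there is an independent set with few neighbours. -/
theorem SimpleGraph.IsTree.exists_independent_far {V : Type*} [Fintype V] {T : SimpleGraph V}
    (hT : T.IsTree) (c : V) {a k : ℕ} (hk : (nbrs T c).card + k + 1 ≤ Fintype.card V)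
    (hak : 2 * a ≤ k) :
    ∃ A : Finset V, A.card = a ∧ c ∉ A ∧ (∀ x ∈ A, ¬ T.Adj c x) ∧
      (∀ x ∈ A, ∀ y ∈ A, ¬ T.Adj x y) ∧ (A.biUnion (nbrs T)).card ≤ k + a := by
  have hS : k ≤ (Finset.univ \ insert c (nbrs T c)).card := by
    have h1 := Finset.le_card_sdiff (insert c (nbrs T c)) Finset.univ
    have h2 := Finset.card_insert_le c (nbrs T c)
    rw [Finset.card_univ] at h1
    omega
  -- Take the `k` vertices farthest from `c`: outside `U` each can only be adjacent to its parent. A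
  -- parity class of distances in `U` is independent.
  obtain ⟨U, hU, hUk, htop⟩ := exists_top_subset (T.dist c) _ k hS
  have hUS : ∀ u ∈ U, u ≠ c ∧ ¬ T.Adj c u := by
    intro u hu
    have := hU hu
    simpa [not_or] using this
  have hnb : ∀ u ∈ U, (nbrs T u \ U).card ≤ 1 := by
    intro u hu
    have hle : ∀ x ∈ nbrs T u \ U, T.dist c x ≤ T.dist c u := by
      intro x hx
      simp only [mem_sdiff, mem_nbrs] at hx
      by_cases hxS : x ∈ Finset.univ \ insert c (nbrs T c)
      · exact htop u hu x hxS hx.2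
      · simp only [mem_sdiff, mem_univ, true_and, mem_insert, mem_nbrs, not_not] at hxS
        rcases hxS with rfl | hxS
        · simp
        · have h1 : T.dist c x = 1 := SimpleGraph.dist_eq_one_iff_adj.2 hxS
          have h2 : T.dist c u ≠ 0 := by
            intro h
            exact (hUS u hu).1 ((hT.connected.dist_eq_zero_iff).1 h).symm
          omega
    refine Finset.card_le_one.2 fun x hx y hy => ?_
    exact hT.eq_of_adj_of_dist_le c (by simpa using (mem_sdiff.1 hx).1)
      (by simpa using (mem_sdiff.1 hy).1) (hle x hx) (hle y hy)
  obtain ⟨r, hr⟩ : ∃ r, a ≤ (U.filter fun u => T.dist c u % 2 = r).card := by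
    have h1 := Finset.card_filter_add_card_filter_not (s := U) (fun u => T.dist c u % 2 = 0)
    have h2 : (U.filter fun u => ¬ T.dist c u % 2 = 0) = U.filter fun u => T.dist c u % 2 = 1 := by
      ext; simp
    rw [h2] at h1
    by_cases h : a ≤ (U.filter fun u => T.dist c u % 2 = 0).card
    · exact ⟨0, h⟩
    · exact ⟨1, by omega⟩
  obtain ⟨A, hA, hAc⟩ := Finset.exists_subset_card_eq hr
  have hAU : A ⊆ U := hA.trans (filter_subset _ _)
  refine ⟨A, hAc, fun h => (hUS c (hAU h)).1 rfl, fun x hx => (hUS x (hAU hx)).2, ?_, ?_⟩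
  · intro x hx y hy hxy
    have h1 := (mem_filter.1 (hA hx)).2
    have h2 := (mem_filter.1 (hA hy)).2
    rcases hT.dist_eq_dist_add_one_of_adj c hxy with h | h <;> omega
  · have hsub : A.biUnion (nbrs T) ⊆ U ∪ A.biUnion fun u => nbrs T u \ U := by
      intro x hx
      obtain ⟨u, hu, hx⟩ := mem_biUnion.1 hx
      by_cases hxU : x ∈ U
      · exact mem_union_left _ hxU
      · exact mem_union_right _ (mem_biUnion.2 ⟨u, hu, mem_sdiff.2 ⟨hx, hxU⟩⟩)
    have h1 := Finset.card_le_card hsub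
    have h2 := Finset.card_union_le U (A.biUnion fun u => nbrs T u \ U)
    have h3 := Finset.card_biUnion_le_card_mul A (fun u => nbrs T u \ U) 1
      fun u hu => hnb u (hAU hu)
    omega

/-- With `c` on `v`, its leaves can go anywhere outside the neighbourhood of `v`. Of that
neighbourhood, `J'` is discarded and the rest is filled by an independent set `A` far from `c`,
whose neighbours are placed in `X'`, where vertices see no neighbour of `v` outside `J`. -/
theorem SimpleGraph.IsTree.isContained_compl_of_large_star {V W : Type*} [Fintype V] [Fintype W]
    {T : SimpleGraph V} {H : SimpleGraph W} (hT : T.IsTree) {m d n : ℕ}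
    (hH : PathsShorter H (d + 2)) (hd : d ≤ 2 * m + 1) (hm : 2 * m ≤ d)
    (hV : Fintype.card V = n) (hW : Fintype.card W = n + m) (hn : 3424 * (d + 2) ^ 4 ≤ n)
    (c : V) (hc : (nbrs T c).card + (d + 2) + 1 ≤ n)
    (hleaf : n ≤ 16 * (leaves T ∩ nbrs T c).card) : T.IsContained Hᶜ := by
  have hn' : 3424 * d ^ 4 + 27392 * d ^ 3 + 82176 * d ^ 2 + 109568 * d + 54784 ≤ n := by
    calc _ = 3424 * (d + 2) ^ 4 := by ring
      _ ≤ n := hn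
  have hd4 : 0 ≤ d ^ 4 := Nat.zero_le _
  have hd3 : 0 ≤ d ^ 3 := Nat.zero_le _
  have : Nonempty W := Fintype.card_pos_iff.1 (by omega)
  obtain ⟨v, hv⟩ := hH.exists_card_nbrs_le
  -- At least `19/20` of the vertices are low, which exceeds the `15/16` of `T` left after removing
  -- the leaves at `c`.
  have hLcard := hH.card_le_card_lowVerts_add (a := 20) (t := 40 * d) (by omega)
  rw [hW] at hLcard
  obtain ⟨J, hJ, X, hXL, hJm, hXJ, hvX, hXv, hXcard⟩ :=
    exists_small_common_nbrs (hH.mono (by omega : d + 2 ≤ 2 * m + 3)) v hv (lowVerts H (40 * d))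
  have hXbig : 42 * d + 5 ≤ X.card := by
    by_contra! hcon
    have h1 : (X.card + m) * (d + 1) ≤ (42 * d + 4 + d) * (d + 1) := by gcongr <;> omega
    have h2 : d * (2 * m + 4) ≤ d * (d + 4) := by gcongr
    have h3 : (42 * d + 4 + d) * (d + 1) = 43 * d ^ 2 + 47 * d + 4 := by ring
    have h4 : d * (d + 4) = d ^ 2 + 4 * d := by ring
    omega
  obtain ⟨X', hX', hX'card⟩ := Finset.exists_subset_card_eq hXbig
  -- Enlarging `J` to size `m`, if possible, leaves at most `d - m ≤ k/2` neighbours of `v` to fill,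
  -- as many as an independent set far from `c` can supply.
  obtain ⟨J', hJJ', hJ'D, hJ'card⟩ := Finset.exists_subsuperset_card_eq (n := min m (nbrs H v).card)
    hJ (le_min hJm (Finset.card_le_card hJ)) (min_le_right _ _)
  have hDcard := Finset.card_sdiff_of_subset hJ'D
  obtain ⟨A, hAcard, hcA, hAc, hAind, hNA⟩ := hT.exists_independent_far c
    (a := (nbrs H v \ J').card) (k := d + 2) (by omega) (by omega)
  obtain ⟨e⟩ : Nonempty (A ≃ (nbrs H v \ J' : Finset W)) :=
    ⟨Finset.equivOfCardEq hAcard⟩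
  let Y := leaves T ∩ nbrs T c
  let P := A.biUnion (nbrs T)
  let Z := Finset.univ \ (Y ∪ insert c A)
  let L' := lowVerts H (40 * d) \ (X' ∪ insert v (nbrs H v))
  have hcY : c ∉ Y := by simp [Y]
  have hAY : ∀ a ∈ A, a ∉ Y := fun a ha h => hAc a ha (by simpa using (mem_inter.1 h).2)
  have hZcard : Z.card + Y.card + 1 ≤ n := by
    have : Disjoint Z (insert c Y) := by
      rw [Finset.disjoint_left]
      intro x hx hx'
      simp only [Z, mem_sdiff, mem_univ, true_and, mem_union, mem_insert] at hx hx'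
      tauto
    have h1 := Finset.card_le_univ (Z ∪ insert c Y)
    rw [Finset.card_union_of_disjoint this, Finset.card_insert_of_notMem hcY] at h1
    omega
  have hL'card : (lowVerts H (40 * d)).card ≤ L'.card + (42 * d + 5) + d + 1 := by
    have h1 := Finset.le_card_sdiff (X' ∪ insert v (nbrs H v)) (lowVerts H (40 * d))
    have h2 := Finset.card_union_le X' (insert v (nbrs H v))
    have h3 := Finset.card_insert_le v (nbrs H v)
    change _ ≤ L'.card at h1
    omega
  have hX'L' : Disjoint X' L' := by
    rw [Finset.disjoint_left]
    intro x hx hx'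
    exact (mem_sdiff.1 hx').2 (mem_union_left _ hx)
  obtain ⟨f, hf1, hf2, hf3⟩ := hT.exists_greedy_embedding H (40 * d)
    (fun z => if z ∈ P then X' else L') Z (by
      intro z _ x hx
      split_ifs at hx
      · simpa using hXL (hX' hx)
      · simpa using (mem_sdiff.1 hx).1) (by
      intro z _
      by_cases hzP : z ∈ P
      · have h1 : (Z.filter fun z' => ¬ Disjoint (if z ∈ P then X' else L')
            (if z' ∈ P then X' else L')) ⊆ P := by
          intro z' hz'
          by_contra h
          have := (mem_filter.1 hz').2
          simp only [hzP, h, if_true, if_false] at this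
          exact this hX'L'
        have h2 := Finset.card_le_card h1
        change P.card ≤ _ at hNA
        simp only [hzP, if_true] at h2 ⊢
        omega
      · have h2 := Finset.card_filter_le Z (fun z' => ¬ Disjoint (if z ∈ P then X' else L')
            (if z' ∈ P then X' else L'))
        simp only [hzP, if_false] at h2 ⊢
        change n ≤ 16 * Y.card at hleaf
        omega)
  have hfD : ∀ z ∈ Z, f z ≠ v ∧ f z ∉ nbrs H v := by
    intro z hz
    have := hf1 z hz
    split_ifs at this
    · exact ⟨fun h => hvX (h ▸ hX' this), Finset.disjoint_left.1 hXv (hX' this)⟩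
    · have := (mem_sdiff.1 this).2
      simp only [mem_union, mem_insert, not_or] at this
      exact this.2
  have hfP : ∀ z ∈ Z, z ∈ P → f z ∈ X' := by
    intro z hz hzP
    simpa [hzP] using hf1 z hz
  let F : V → W := fun z => if z = c then v else if h : z ∈ A then e ⟨z, h⟩ else f z
  have hFc : F c = v := if_pos rfl
  have hFA : ∀ z (h : z ∈ A), F z = e ⟨z, h⟩ := by
    intro z h
    have : z ≠ c := by rintro rfl; exact hcA h
    simp [F, this, h]
  have hFAm : ∀ z ∈ A, F z ∈ nbrs H v \ J' := fun z h => by rw [hFA z h]; exact (e _).2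
  have hFZ : ∀ z ∈ Z, F z = f z := by
    intro z h
    have : z ≠ c ∧ z ∉ A := by simp [Z] at h; tauto
    simp [F, this]
  have hcases : ∀ z ∉ Y, z = c ∨ z ∈ A ∨ z ∈ Z := by
    intro z hz
    simp only [Z, mem_sdiff, mem_univ, true_and, mem_union, mem_insert, not_or]
    tauto
  have hvD : v ∉ nbrs H v := by simp
  have hAX : ∀ a ∈ A, ∀ x ∈ X', ¬ H.Adj (F a) x := by
    intro a ha x hx h
    have h1 := mem_sdiff.1 (hFAm a ha)
    exact h1.2 (hJJ' (hXJ x (hX' hx) (mem_inter.2 ⟨by simpa using h.symm, h1.1⟩)))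
  have hadjAZ : ∀ a ∈ A, ∀ z ∈ Z, T.Adj a z → ¬ H.Adj (F a) (F z) := by
    intro a ha z hz haz
    rw [hFZ z hz]
    exact hAX a ha _ (hfP z hz (mem_biUnion.2 ⟨a, ha, by simpa using haz⟩))
  have hadjcZ : ∀ z ∈ Z, ¬ H.Adj (F c) (F z) := by
    intro z hz h
    rw [hFc, hFZ z hz] at h
    exact (hfD z hz).2 (by simpa using h)
  refine isContained_compl_of_hall (t := d) (Y := Y)
    (R := Finset.univ \ (J' ∪ (Finset.univ \ Y).image F)) (f := F) ?_ ?_ ?_ ?_ ?_ ?_ ?_ ?_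
  · exact fun a ha b hb => hT.not_adj_leaves (by omega) (mem_inter.1 ha).1 (mem_inter.1 hb).1
  · intro y hy
    have := mem_leaves.1 (mem_inter.1 hy).1
    omega
  · have hne : ∀ a ∈ A, F a ≠ F c := fun a ha h => hvD (by
      have := (mem_sdiff.1 (hFAm a ha)).1
      rwa [h, hFc] at this)
    have hne2 : ∀ z ∈ Z, F z ≠ F c := fun z hz h => (hfD z hz).1 (by rw [← hFZ z hz, h, hFc])
    have hne3 : ∀ a ∈ A, ∀ z ∈ Z, F a ≠ F z := fun a ha z hz h => (hfD z hz).2 (by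
      rw [← hFZ z hz, ← h]; exact (mem_sdiff.1 (hFAm a ha)).1)
    intro a ha b hb hab
    rcases hcases a ha with rfl | ha' | ha' <;> rcases hcases b hb with rfl | hb' | hb'
    · rfl
    · exact absurd hab.symm (hne b hb')
    · exact absurd hab.symm (hne2 b hb')
    · exact absurd hab (hne a ha')
    · rw [hFA a ha', hFA b hb'] at hab
      exact congrArg Subtype.val (e.injective (Subtype.ext hab))
    · exact absurd hab (hne3 a ha' b hb')
    · exact absurd hab (hne2 a ha')
    · exact absurd hab.symm (hne3 b hb' a ha')
    · rw [hFZ a ha', hFZ b hb'] at hab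
      exact hf2 ha' hb' hab
  · intro a ha b hb hab
    rcases hcases a ha with rfl | ha' | ha' <;> rcases hcases b hb with rfl | hb' | hb'
    · exact absurd rfl hab.ne
    · exact absurd hab (hAc b hb')
    · exact hadjcZ b hb'
    · exact absurd hab.symm (hAc a ha')
    · exact absurd hab (hAind a ha' b hb')
    · exact hadjAZ a ha' b hb' hab
    · exact fun h => hadjcZ a ha' h.symm
    · exact fun h => hadjAZ b hb' a ha' hab.symm h.symm
    · rw [hFZ a ha', hFZ b hb']
      exact hf3 a ha' b hb' hab
  · intro y hy q hq
    rw [mem_inter] at hy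
    rw [eq_of_adj_of_mem_leaves hy.1 hq (mem_nbrs.1 hy.2).symm, hFc]
    exact hv
  · intro a ha h
    exact (mem_sdiff.1 h).2 (mem_union_right _ (mem_image_of_mem F (by simpa using ha)))
  · have h1 := Finset.le_card_sdiff (J' ∪ (Finset.univ \ Y).image F) Finset.univ
    have h2 := Finset.card_union_le J' ((Finset.univ \ Y).image F)
    have h3 : ((Finset.univ \ Y).image F).card ≤ (Finset.univ \ Y).card := Finset.card_image_le
    have h4 := Finset.card_sdiff_of_subset (Finset.subset_univ Y)
    have h5 := Finset.card_le_univ Y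
    rw [Finset.card_univ] at h1 h4
    omega
  · intro w hw
    have hwD : ¬ H.Adj v w := by
      intro h
      rw [mem_sdiff, mem_union, not_or] at hw
      have hwD : w ∈ nbrs H v \ J' := mem_sdiff.2 ⟨by simpa using h, hw.2.1⟩
      apply hw.2.2
      refine mem_image.2 ⟨e.symm ⟨w, hwD⟩, ?_, ?_⟩
      · simpa using hAY _ (e.symm ⟨w, hwD⟩).2
      · rw [hFA _ (e.symm ⟨w, hwD⟩).2]
        simp
    rw [Finset.filter_true_of_mem]
    · change n ≤ 16 * Y.card at hleaf
      omega
    · intro y hy q hq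
      rw [mem_inter] at hy
      rw [eq_of_adj_of_mem_leaves hy.1 hq (mem_nbrs.1 hy.2).symm, hFc]
      exact hwD

end LargeStar


/-! ### Trees without a dominating star, and assembly of the cases. -/

section ScatteredLeaves

open scoped Classical

/-- Put `p₁`, `p₂` on `v₁`, `v₂` with common neighbours inside `J`. A vertex outside `J` misses one
of the two, so it is available to all leaves there. -/
theorem SimpleGraph.IsTree.isContained_compl_of_two_stars {V W : Type*} [Fintype V] [Fintype W]
    {T : SimpleGraph V} {H : SimpleGraph W} (hT : T.IsTree) {m d n t : ℕ}
    (hH : PathsShorter H (d + 2)) (hd : d ≤ 2 * m + 1) (hm : 2 * m ≤ d)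
    (hV : Fintype.card V = n) (hW : Fintype.card W = n + m) (hn : 3424 * (d + 2) ^ 4 ≤ n)
    (ht : t = 14 * d + 2) {p₁ p₂ : V} (hp : p₁ ≠ p₂)
    (h₁ : 2 * t ≤ (leaves T ∩ nbrs T p₁).card) (h₂ : 2 * t ≤ (leaves T ∩ nbrs T p₂).card) :
    T.IsContained Hᶜ := by
  have hn' : 3424 * d ^ 4 + 27392 * d ^ 3 + 82176 * d ^ 2 + 109568 * d + 54784 ≤ n := by
    calc _ = 3424 * (d + 2) ^ 4 := by ring
      _ ≤ n := hn
  have hd4 : 0 ≤ d ^ 4 := Nat.zero_le _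
  have hd3 : 0 ≤ d ^ 3 := Nat.zero_le _
  have : Nonempty W := Fintype.card_pos_iff.1 (by omega)
  -- At least `6/7` of the vertices are low, against at most `5/6` of `T` to be embedded greedily.
  have hLcard := hH.card_le_card_lowVerts_add (a := 7) (t := t) (by omega)
  rw [hW] at hLcard
  obtain ⟨v₁, hv₁⟩ : (lowVerts H t).Nonempty := Finset.card_pos.1 (by omega)
  rw [mem_lowVerts] at hv₁
  obtain ⟨J, -, X, hXL, hJm, hXJ, hvX, hXv, hXcard⟩ :=
    exists_small_common_nbrs (hH.mono (by omega : d + 2 ≤ 2 * m + 3)) v₁ hv₁ (lowVerts H t)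
  obtain ⟨v₂, hv₂X⟩ : X.Nonempty := by
    rw [← Finset.card_pos]
    by_contra! hcon
    have h0 : X.card = 0 := by omega
    rw [h0] at hXcard
    have h1 : (0 + m) * (t + 1) ≤ d * (t + 1) := by gcongr; omega
    have h2 : t * (2 * m + 4) ≤ t * (d + 4) := by gcongr
    have h3 : d * (t + 1) = 14 * d ^ 2 + 3 * d := by subst ht; ring
    have h4 : t * (d + 4) = 14 * d ^ 2 + 58 * d + 8 := by subst ht; ring
    omega
  have hv₂ : (nbrs H v₂).card ≤ t := by simpa using hXL hv₂X
  have hv12 : v₁ ≠ v₂ := by rintro rfl; exact hvX hv₂X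
  have hnadj : ¬ H.Adj v₁ v₂ := by
    simpa using Finset.disjoint_left.1 hXv hv₂X
  have hJ : ∀ w, H.Adj v₁ w → H.Adj v₂ w → w ∈ J := fun w h1 h2 =>
    hXJ v₂ hv₂X (by simp [h1, h2])
  obtain ⟨Y, hYl, hYind, hYdeg, hYcard⟩ := hT.exists_independent_low (by omega) (leaves T)
    (fun a ha b hb => hT.not_adj_leaves (by omega) ha hb)
    (fun a ha => by rw [mem_leaves.1 ha]; omega)
  have hpY : ∀ p, 2 * t ≤ (leaves T ∩ nbrs T p).card → p ∉ Y := by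
    intro p hp hpY
    obtain ⟨u, hu⟩ : (leaves T ∩ nbrs T p).Nonempty := Finset.card_pos.1 (by omega)
    rw [mem_inter, mem_nbrs] at hu
    exact hYind p hpY u (hYl hu.1) hu.2
  let Z := Finset.univ \ (Y ∪ {p₁, p₂})
  let F := insert v₁ (nbrs H v₁) ∪ insert v₂ (nbrs H v₂)
  let L' := lowVerts H t \ F
  have hZcard : Z.card + Y.card ≤ n := by
    have h1 := Finset.card_sdiff_of_subset (Finset.subset_univ (Y ∪ {p₁, p₂}))
    have h2 : Y.card ≤ (Y ∪ {p₁, p₂}).card := Finset.card_le_card subset_union_left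
    have h3 := Finset.card_le_univ (Y ∪ {p₁, p₂})
    rw [Finset.card_univ] at h1
    change Z.card = _ at h1
    omega
  have hL'card : (lowVerts H t).card ≤ L'.card + 2 * t + 2 := by
    have h1 := Finset.le_card_sdiff F (lowVerts H t)
    have h2 := Finset.card_union_le (insert v₁ (nbrs H v₁)) (insert v₂ (nbrs H v₂))
    have h3 := Finset.card_insert_le v₁ (nbrs H v₁)
    have h4 := Finset.card_insert_le v₂ (nbrs H v₂)
    change _ ≤ L'.card at h1
    change F.card ≤ _ at h2
    omega
  obtain ⟨f, hf1, hf2, hf3⟩ := hT.exists_greedy_embedding H t (fun _ => L') Z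
    (fun z _ x hx => by simpa using (mem_sdiff.1 hx).1) (by
      intro z _
      have := Finset.card_filter_le Z (fun _ => ¬ Disjoint L' L')
      omega)
  have hfF : ∀ z ∈ Z, f z ≠ v₁ ∧ f z ≠ v₂ ∧ ¬ H.Adj v₁ (f z) ∧ ¬ H.Adj v₂ (f z) := by
    intro z hz
    have := (mem_sdiff.1 (hf1 z hz)).2
    simp only [F, mem_union, mem_insert, mem_nbrs] at this
    tauto
  let G : V → W := fun z => if z = p₁ then v₁ else if z = p₂ then v₂ else f z
  have hG1 : G p₁ = v₁ := if_pos rfl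
  have hG2 : G p₂ = v₂ := by simp [G, hp.symm]
  have hGZ : ∀ z ∈ Z, G z = f z := by
    intro z hz
    have : z ≠ p₁ ∧ z ≠ p₂ := by simp [Z] at hz; tauto
    simp [G, this]
  have hcases : ∀ z ∉ Y, z = p₁ ∨ z = p₂ ∨ z ∈ Z := by
    intro z hz
    simp only [Z, mem_sdiff, mem_univ, true_and, mem_union, mem_insert, mem_singleton]
    tauto
  have hlow : ∀ z ∉ Y, (nbrs H (G z)).card ≤ t := by
    intro z hz
    rcases hcases z hz with rfl | rfl | hz
    · rwa [hG1]
    · rwa [hG2]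
    · rw [hGZ z hz]
      simpa using (mem_sdiff.1 (hf1 z hz)).1
  refine isContained_compl_of_hall (t := t) (Y := Y)
    (R := Finset.univ \ (J ∪ (Finset.univ \ Y).image G)) (f := G) hYind hYdeg ?_ ?_
    (fun y hy q hq => hlow q fun hqY => hYind y hy q hqY hq) ?_ ?_ ?_
  · intro a ha b hb hab
    rcases hcases a ha with ha' | ha' | ha' <;> rcases hcases b hb with hb' | hb' | hb'
    · rw [ha', hb']
    · rw [ha', hb', hG1, hG2] at hab; exact absurd hab hv12
    · rw [ha', hG1, hGZ b hb'] at hab; exact absurd hab.symm (hfF b hb').1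
    · rw [ha', hb', hG1, hG2] at hab; exact absurd hab.symm hv12
    · rw [ha', hb']
    · rw [ha', hG2, hGZ b hb'] at hab; exact absurd hab.symm (hfF b hb').2.1
    · rw [hb', hG1, hGZ a ha'] at hab; exact absurd hab (hfF a ha').1
    · rw [hb', hG2, hGZ a ha'] at hab; exact absurd hab (hfF a ha').2.1
    · rw [hGZ a ha', hGZ b hb'] at hab
      exact hf2 ha' hb' hab
  · intro a ha b hb hab
    rcases hcases a ha with ha' | ha' | ha' <;> rcases hcases b hb with hb' | hb' | hb'
    · exact absurd (ha'.trans hb'.symm) hab.ne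
    · rwa [ha', hb', hG1, hG2]
    · rw [ha', hG1, hGZ b hb']; exact (hfF b hb').2.2.1
    · rw [ha', hb', hG1, hG2]; exact fun h => hnadj h.symm
    · exact absurd (ha'.trans hb'.symm) hab.ne
    · rw [ha', hG2, hGZ b hb']; exact (hfF b hb').2.2.2
    · rw [hb', hG1, hGZ a ha']; exact fun h => (hfF a ha').2.2.1 h.symm
    · rw [hb', hG2, hGZ a ha']; exact fun h => (hfF a ha').2.2.2 h.symm
    · rw [hGZ a ha', hGZ b hb']
      exact hf3 a ha' b hb' hab
  · intro a ha h
    exact (mem_sdiff.1 h).2 (mem_union_right _ (mem_image_of_mem G (by simpa using ha)))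
  · have h1 := Finset.le_card_sdiff (J ∪ (Finset.univ \ Y).image G) Finset.univ
    have h2 := Finset.card_union_le J ((Finset.univ \ Y).image G)
    have h3 : ((Finset.univ \ Y).image G).card ≤ (Finset.univ \ Y).card := Finset.card_image_le
    have h4 := Finset.card_sdiff_of_subset (Finset.subset_univ Y)
    have h5 := Finset.card_le_univ Y
    rw [Finset.card_univ] at h1 h4
    omega
  · intro w hw
    have hwJ : w ∉ J := fun h => (mem_sdiff.1 hw).2 (mem_union_left _ h)
    have key : ∀ p v, G p = v → ¬ H.Adj v w → 2 * t ≤ (leaves T ∩ nbrs T p).card →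
        2 * t ≤ (Y.filter fun y => ∀ q, T.Adj y q → ¬ H.Adj (G q) w).card := by
      intro p v hGp hvw hpt
      refine hpt.trans (Finset.card_le_card fun y hy => ?_)
      rw [mem_inter, mem_nbrs] at hy
      refine mem_filter.2 ⟨hYl hy.1, fun q hq => ?_⟩
      rwa [eq_of_adj_of_mem_leaves hy.1 hq hy.2.symm, hGp]
    by_cases hw1 : H.Adj v₁ w
    · exact key p₂ v₂ hG2 (fun h => hwJ (hJ w hw1 h)) h₂
    · exact key p₁ v₁ hG1 hw1 h₁

/-- If no `τ` vertices of `T` dominate almost all of `Y`, then `T` embeds: only the vertices of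
degree at least `τ` are then hard to reach, and they are avoided by the neighbours of `Y₂`. -/
theorem SimpleGraph.IsTree.isContained_compl_of_not_dominated {V W : Type*} [Fintype V] [Fintype W]
    {T : SimpleGraph V} {H : SimpleGraph W} (hT : T.IsTree) {m d n t τ : ℕ}
    (hH : PathsShorter H (d + 2)) (hd : d ≤ 2 * m + 1) (hm : 2 * m ≤ d)
    (hV : Fintype.card V = n) (hW : Fintype.card W = n + m) (hn : 3424 * (d + 2) ^ 4 ≤ n)
    (ht : t = 14 * d + 2) (hτ : n < 16 * t * (τ + 1)) {Y Y₂ : Finset V}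
    (hYind : ∀ a ∈ Y, ∀ b ∈ Y, ¬ T.Adj a b) (hYdeg : ∀ a ∈ Y, (nbrs T a).card ≤ 2)
    (hYcard : n ≤ 6 * Y.card) (hY₂ : Y₂ ⊆ Y) (hY₂card : Y₂.card = 2 * t)
    (hdom : ∀ P : Finset V, P.card < τ →
      2 * t ≤ (Y.filter fun y => ∀ q, T.Adj y q → q ∉ P).card) :
    T.IsContained Hᶜ := by
  have hn' : 3424 * d ^ 4 + 27392 * d ^ 3 + 82176 * d ^ 2 + 109568 * d + 54784 ≤ n := by
    calc _ = 3424 * (d + 2) ^ 4 := by ring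
      _ ≤ n := hn
  have hd4 : 0 ≤ d ^ 4 := Nat.zero_le _
  have hd3 : 0 ≤ d ^ 3 := Nat.zero_le _
  have : Nonempty W := Fintype.card_pos_iff.1 (by omega)
  have hLcard := hH.card_le_card_lowVerts_add (a := 7) (t := t) (by omega)
  rw [hW] at hLcard
  have hτt : 14 * d + 6 ≤ τ := by
    by_contra! hcon
    have h1 : 16 * t * (τ + 1) ≤ 16 * t * (14 * d + 6) := Nat.mul_le_mul_left _ (by omega)
    have h2 : 16 * t * (14 * d + 6) = 3136 * d ^ 2 + 1792 * d + 192 := by subst ht; ring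
    omega
  let B : Finset W := Finset.univ.filter fun b => τ ≤ (nbrs H b).card
  -- From `|B| τ ≤ 2d(n + m)` and `τ` about `n / (16t)`: the ratio is about `32dt`, and `33` absorbs
  -- the rounding.
  have hBcard : B.card ≤ 33 * d * t := by
    have h1 := hH.card_mul_le τ B fun b hb => (mem_filter.1 hb).2
    rw [hW] at h1
    by_contra! hcon
    have h2 : (33 * d * t + 1) * τ ≤ 2 * d * (n + m) := (Nat.mul_le_mul_right _ hcon).trans h1
    rcases Nat.eq_zero_or_pos d with rfl | hd0
    · simp at h2; omega
    · have h3 : d * (33 * t * τ) ≤ d * (2 * (n + m)) := by nlinarith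
      have h4 := Nat.le_of_mul_le_mul_left h3 hd0
      have h5 : 16 * t * (τ + 1) = 16 * (t * τ) + 16 * t := by ring
      have h6 : 33 * t * τ = 33 * (t * τ) := by ring
      omega
  obtain ⟨J, hJB, X, hXL, hJm, hXJ, hXcard⟩ :=
    exists_small_trace (hH.mono (by omega : d + 2 ≤ 2 * m + 3)) B (lowVerts H t) (by
      rw [Finset.disjoint_left]
      intro b hb hb'
      have := (mem_filter.1 hb).2
      rw [mem_lowVerts] at hb'
      omega) (fun b hb => by
      have := (mem_filter.1 hb).2
      omega)
  -- The list for `P` must exceed `t` plus the at most `4t` members of `P`.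
  have hXbig : 5 * t + 1 ≤ X.card := by
    by_contra! hcon
    have h1 : (X.card + m) * (B.card + 1) ≤ (5 * t + d) * (33 * d * t + 1) := by
      gcongr <;> omega
    have h2 : (5 * t + d) * (33 * d * t + 1) =
        32802 * d ^ 3 + 9306 * d ^ 2 + 731 * d + 10 := by subst ht; ring
    have h3 : 32802 * d ^ 3 ≤ 2900 * d ^ 4 + 23000 * d ^ 3 + 20000 * d ^ 2 := by
      have : (32802 * d ^ 3 : ℤ) ≤ 2900 * d ^ 4 + 23000 * d ^ 3 + 20000 * d ^ 2 := by
        have h4 : (2900 * d ^ 4 + 23000 * d ^ 3 + 20000 * d ^ 2 - 32802 * d ^ 3 : ℤ) =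
            d ^ 2 * (2900 * d ^ 2 - 9802 * d + 20000) := by ring
        have h5 : (0 : ℤ) ≤ 2900 * d ^ 2 - 9802 * d + 20000 := by
          nlinarith [sq_nonneg (d - 2 : ℤ)]
        have := mul_nonneg (sq_nonneg (d : ℤ)) h5
        linarith
      exact_mod_cast this
    omega
  obtain ⟨X', hX', hX'card⟩ := Finset.exists_subset_card_eq hXbig
  let P := Y₂.biUnion (nbrs T)
  have hPcard : P.card ≤ 4 * t := by
    have := Finset.card_biUnion_le_card_mul Y₂ (nbrs T) 2 fun y hy => hYdeg y (hY₂ hy)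
    change P.card ≤ _ at this
    omega
  let L' := lowVerts H t \ X'
  have hL'card : (lowVerts H t).card ≤ L'.card + (5 * t + 1) := by
    have h1 := Finset.le_card_sdiff X' (lowVerts H t)
    change _ ≤ L'.card at h1
    omega
  have hX'L' : Disjoint X' L' := Finset.disjoint_sdiff
  have hYn : Y.card ≤ n := hV ▸ Finset.card_le_univ Y
  have hZcard : (Finset.univ \ Y).card = n - Y.card := by
    rw [Finset.card_sdiff_of_subset (Finset.subset_univ Y), Finset.card_univ, hV]
  obtain ⟨f, hf1, hf2, hf3⟩ := hT.exists_greedy_embedding H t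
    (fun z => if z ∈ P then X' else L') (Finset.univ \ Y) (by
      intro z _ x hx
      split_ifs at hx
      · simpa using hXL (hX' hx)
      · simpa using (mem_sdiff.1 hx).1) (by
      intro z _
      by_cases hzP : z ∈ P
      · have h1 : ((Finset.univ \ Y).filter fun z' => ¬ Disjoint (if z ∈ P then X' else L')
            (if z' ∈ P then X' else L')) ⊆ P := by
          intro z' hz'
          by_contra h
          have := (mem_filter.1 hz').2
          simp only [hzP, h, if_true, if_false] at this
          exact this hX'L'
        have h2 := Finset.card_le_card h1
        simp only [hzP, if_true] at h2 ⊢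
        omega
      · have h2 := Finset.card_filter_le (Finset.univ \ Y)
          (fun z' => ¬ Disjoint (if z ∈ P then X' else L') (if z' ∈ P then X' else L'))
        simp only [hzP, if_false] at h2 ⊢
        omega)
  have hmem : ∀ z ∉ Y, z ∈ Finset.univ \ Y := fun z hz => by simpa using hz
  have hlow : ∀ z ∉ Y, (nbrs H (f z)).card ≤ t := by
    intro z hz
    have := hf1 z (hmem z hz)
    split_ifs at this
    · simpa using hXL (hX' this)
    · simpa using (mem_sdiff.1 this).1
  have hnY : ∀ y ∈ Y, ∀ q, T.Adj y q → q ∉ Y := fun y hy q hq hqY => hYind y hy q hqY hq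
  refine isContained_compl_of_hall (t := t) (Y := Y)
    (R := Finset.univ \ (J ∪ (Finset.univ \ Y).image f)) (f := f) hYind hYdeg
    (fun a ha b hb hab => hf2 (by simpa using ha) (by simpa using hb) hab)
    (fun a ha b hb => hf3 a (hmem a ha) b (hmem b hb))
    (fun y hy q hq => hlow q (hnY y hy q hq)) ?_ ?_ ?_
  · intro a ha h
    exact (mem_sdiff.1 h).2 (mem_union_right _ (mem_image_of_mem f (hmem a ha)))
  · have h1 := Finset.le_card_sdiff (J ∪ (Finset.univ \ Y).image f) Finset.univ
    have h2 := Finset.card_union_le J ((Finset.univ \ Y).image f)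
    have h3 : ((Finset.univ \ Y).image f).card ≤ (Finset.univ \ Y).card := Finset.card_image_le
    rw [Finset.card_univ] at h1
    omega
  · intro w hw
    have hwJ : w ∉ J := fun h => (mem_sdiff.1 hw).2 (mem_union_left _ h)
    -- Vertices of `B` outside `J` are available to all of `Y₂`. Any other `w` is adjacent to fewer
    -- than `τ` images, and `hdom` applies to their preimages.
    by_cases hwB : w ∈ B
    · rw [← hY₂card]
      refine Finset.card_le_card fun y hy => mem_filter.2 ⟨hY₂ hy, fun q hq hadj => hwJ ?_⟩
      have hqP : q ∈ P := mem_biUnion.2 ⟨y, hy, by simpa using hq⟩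
      have hfq := hf1 q (hmem q (hnY y (hY₂ hy) q hq))
      simp only [hqP, if_true] at hfq
      exact hXJ _ (hX' hfq) (mem_inter.2 ⟨by simpa using hadj, hwB⟩)
    · have hwτ : (nbrs H w).card < τ := by simpa [B] using hwB
      have hPc : ((Finset.univ \ Y).filter fun q => H.Adj (f q) w).card ≤ (nbrs H w).card := by
        refine Finset.card_le_card_of_injOn f (fun q hq => ?_) fun a ha b hb hab => ?_
        · simpa using (mem_filter.1 hq).2.symm
        · exact hf2 (mem_filter.1 ha).1 (mem_filter.1 hb).1 hab
      refine (hdom _ (hPc.trans_lt hwτ)).trans (Finset.card_le_card fun y hy => ?_)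
      rw [mem_filter] at hy ⊢
      refine ⟨hy.1, fun q hq hadj => hy.2 q hq (mem_filter.2 ⟨hmem q (hnY y hy.1 q hq), hadj⟩)⟩

theorem SimpleGraph.IsTree.isContained_compl {V W : Type*} [Fintype V] [Fintype W]
    {T : SimpleGraph V} {H : SimpleGraph W} (hT : T.IsTree) {m d n : ℕ}
    (hH : PathsShorter H (d + 2)) (hd : d ≤ 2 * m + 1) (hm : 2 * m ≤ d)
    (hV : Fintype.card V = n) (hW : Fintype.card W = n + m) (hn : 3424 * (d + 2) ^ 4 ≤ n)
    (hΔ : ∀ c, (nbrs T c).card + (d + 2) + 1 ≤ n) : T.IsContained Hᶜ := by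
  have hn' : 3424 * d ^ 4 + 27392 * d ^ 3 + 82176 * d ^ 2 + 109568 * d + 54784 ≤ n := by
    calc _ = 3424 * (d + 2) ^ 4 := by ring
      _ ≤ n := hn
  have hd4 : 0 ≤ d ^ 4 := Nat.zero_le _
  have hd3 : 0 ≤ d ^ 3 := Nat.zero_le _
  have : Nonempty V := Fintype.card_pos_iff.1 (by omega)
  by_cases hstar : ∃ c, n ≤ 16 * (leaves T ∩ nbrs T c).card
  · obtain ⟨c, hc⟩ := hstar
    exact hT.isContained_compl_of_large_star hH hd hm hV hW hn c (hΔ c) hc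
  push Not at hstar
  obtain ⟨t, ht⟩ : ∃ t, t = 14 * d + 2 := ⟨_, rfl⟩
  by_cases htwo : ∃ p₁ p₂, p₁ ≠ p₂ ∧ 2 * t ≤ (leaves T ∩ nbrs T p₁).card ∧
      2 * t ≤ (leaves T ∩ nbrs T p₂).card
  · obtain ⟨p₁, p₂, hp, h₁, h₂⟩ := htwo
    exact hT.isContained_compl_of_two_stars hH hd hm hV hW hn ht hp h₁ h₂
  obtain ⟨c, hc⟩ : ∃ c, ∀ q, q ≠ c → (leaves T ∩ nbrs T q).card ≤ 2 * t := by
    by_cases h : ∃ c, 2 * t ≤ (leaves T ∩ nbrs T c).card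
    · obtain ⟨c, h⟩ := h
      refine ⟨c, fun q hq => ?_⟩
      by_contra! hlt
      exact htwo ⟨q, c, hq, hlt.le, h⟩
    · push Not at h
      exact ⟨Classical.arbitrary V, fun q _ => (h q).le⟩
  obtain ⟨τ, hτdef⟩ : ∃ τ, τ = n / (16 * t) := ⟨_, rfl⟩
  have hτ1 : n < 16 * t * (τ + 1) := by
    rw [hτdef]
    exact Nat.lt_mul_div_succ n (by omega)
  have hτ2 : 16 * (t * τ) ≤ n := by
    rw [hτdef, ← mul_assoc]
    exact Nat.mul_div_le n (16 * t)
  have hleaf : (leaves T).card ≤ (leaves T \ nbrs T c).card + (leaves T ∩ nbrs T c).card := by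
    rw [Finset.card_sdiff_add_card_inter]
  have hlc := hstar c
  -- Every vertex but `c` has at most `2t` leaves, so many leaves away from `c` cannot be dominated
  -- by fewer than `τ` vertices. Otherwise leaves are few, and in a scattered `Y₁` each vertex
  -- dominates at most one member.
  by_cases hb : 2 * (t * τ) + 2 * t ≤ (leaves T \ nbrs T c).card
  · obtain ⟨Y, hYl, hYind, hYdeg, hYcard⟩ := hT.exists_independent_low (by omega) (leaves T)
      (fun a ha b hb => hT.not_adj_leaves (by omega) ha hb)
      (fun a ha => by rw [mem_leaves.1 ha]; omega)
    obtain ⟨Y₂, hY₂, hY₂card⟩ := Finset.exists_subset_card_eq (s := Y) (n := 2 * t) (by omega)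
    refine hT.isContained_compl_of_not_dominated hH hd hm hV hW hn ht hτ1 hYind hYdeg
      (hV ▸ hYcard) hY₂ hY₂card fun P hP => ?_
    let D := (P.erase c).biUnion fun q => leaves T ∩ nbrs T q
    have hD : D.card ≤ 2 * (t * τ) := by
      have h1 : D.card ≤ (P.erase c).card * (2 * t) :=
        Finset.card_biUnion_le_card_mul _ _ _ fun q hq => hc q (mem_erase.1 hq).1
      have h2 : (P.erase c).card ≤ τ := (Finset.card_erase_le).trans hP.le
      nlinarith
    have hsub : (leaves T \ nbrs T c) \ D ⊆ Y.filter fun y => ∀ q, T.Adj y q → q ∉ P := by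
      intro y hy
      simp only [mem_sdiff, mem_nbrs] at hy
      refine mem_filter.2 ⟨hYl hy.1.1, fun q hq hqP => hy.2 ?_⟩
      have hqc : q ≠ c := by rintro rfl; exact hy.1.2 hq.symm
      exact mem_biUnion.2 ⟨q, mem_erase.2 ⟨hqc, hqP⟩, mem_inter.2 ⟨hy.1.1, by simpa using hq.symm⟩⟩
    have h1 := Finset.card_le_card hsub
    have h2 := Finset.le_card_sdiff D (leaves T \ nbrs T c)
    omega
  · obtain ⟨Y₁, hind, hdeg, hdisj, hcard⟩ := hT.exists_scattered_low (by omega)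
    have hτn : 32 * τ ≤ n := by
      have : 2 * τ ≤ t * τ := Nat.mul_le_mul_right _ (by omega)
      omega
    have hY₁ : τ + 2 * t ≤ Y₁.card := by omega
    obtain ⟨Y, hY₁Y, hYind, hYdeg, hYcard⟩ := hT.exists_independent_low (by omega) Y₁ hind hdeg
    obtain ⟨Y₂, hY₂, hY₂card⟩ := Finset.exists_subset_card_eq (s := Y) (n := 2 * t) (by omega)
    refine hT.isContained_compl_of_not_dominated hH hd hm hV hW hn ht hτ1 hYind hYdeg
      (hV ▸ hYcard) hY₂ hY₂card fun P hP => ?_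
    have h1 := Finset.card_filter_add_card_filter_not (s := Y₁) (fun y => ∀ q, T.Adj y q → q ∉ P)
    have h2 : (Y₁.filter fun y => ¬ ∀ q, T.Adj y q → q ∉ P).card ≤ P.card := by
      have hex : ∀ y, ∃ q, (¬ ∀ q, T.Adj y q → q ∉ P) → T.Adj y q ∧ q ∈ P := by
        intro y
        by_cases h : ∀ q, T.Adj y q → q ∉ P
        · exact ⟨y, fun h' => absurd h h'⟩
        · push Not at h
          obtain ⟨q, hq⟩ := h
          exact ⟨q, fun _ => hq⟩
      choose g hg using hex
      refine Finset.card_le_card_of_injOn g (fun y hy => (hg y (mem_filter.1 hy).2).2) ?_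
      intro a ha b hb hab
      rw [mem_coe, mem_filter] at ha hb
      by_contra hne
      have hgb := (hg b hb.2).1
      rw [← hab] at hgb
      exact Finset.disjoint_left.1 (hdisj a ha.1 b hb.1 hne) (mem_nbrs.2 (hg a ha.2).1)
        (mem_nbrs.2 hgb)
    have h3 : (Y₁.filter fun y => ∀ q, T.Adj y q → q ∉ P).card ≤
        (Y.filter fun y => ∀ q, T.Adj y q → q ∉ P).card :=
      Finset.card_le_card (Finset.filter_subset_filter _ hY₁Y)
    omega

end ScatteredLeaves


/-! ### The lower bound construction and the theorem. -/

/-- The disjoint union of the complete graphs on the vertices below `s` and on the others. -/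
def twoCliques (M s : ℕ) : SimpleGraph (Fin M) where
  Adj i j := i ≠ j ∧ (i.1 < s ↔ j.1 < s)
  symm := ⟨fun _ _ h => ⟨h.1.symm, h.2.symm⟩⟩
  loopless := ⟨fun _ h => h.1 rfl⟩

theorem not_isContained_twoCliques {V : Type*} [Fintype V] {T : SimpleGraph V}
    (hT : T.Connected) {M s : ℕ} (hs : s < Fintype.card V) (hM : M - s < Fintype.card V) :
    ¬ T.IsContained (twoCliques M s) := by
  rintro ⟨⟨f, hf⟩⟩
  have hf' : Function.Injective fun v => (f v).1 := fun a b h => hf (Fin.ext h)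
  have hside : ∀ u v : V, (f u).1 < s ↔ (f v).1 < s := by
    intro u v
    obtain ⟨p⟩ := hT u v
    induction p with
    | nil => rfl
    | cons h p ih => exact (f.map_adj h).2.trans ih
  obtain ⟨c⟩ := hT.nonempty
  by_cases hc : (f c).1 < s
  · have := Finset.card_le_card_of_injOn (s := Finset.univ) (t := Finset.range s)
      (fun v => (f v).1) (fun v _ => by simpa using (hside c v).1 hc) hf'.injOn
    simp at this
    omega
  · have := Finset.card_le_card_of_injOn (s := Finset.univ) (t := Finset.Ico s M)
      (fun v => (f v).1) (fun v _ => by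
        have := (hside c v).not.1 hc
        simpa using this) hf'.injOn
    simp at this
    omega

/-- The part from `s` on is a vertex cover of the complement, while the path has `⌊k/2⌋` disjoint
edges. -/
theorem not_pathGraph_isContained_compl_twoCliques {M s k : ℕ} (h : M - s < k / 2) :
    ¬ (pathGraph k).IsContained (twoCliques M s)ᶜ := by
  rintro ⟨⟨f, hf⟩⟩
  have hex : ∀ i : Fin (k / 2), ∃ j : Fin k, j.1 / 2 = i.1 ∧ s ≤ (f j).1 := by
    intro i
    have h1 : 2 * i.1 + 1 < k := by omega
    let a : Fin k := ⟨2 * i.1, by omega⟩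
    let b : Fin k := ⟨2 * i.1 + 1, h1⟩
    have hab : (twoCliques M s)ᶜ.Adj (f a) (f b) :=
      f.map_adj (pathGraph_adj.2 (Or.inl rfl))
    rw [compl_adj] at hab
    by_cases ha : s ≤ (f a).1
    · exact ⟨a, by simp [a], ha⟩
    · refine ⟨b, by simp [b]; omega, ?_⟩
      by_contra hb
      exact hab.2 ⟨hab.1, by omega⟩
  choose g hg1 hg2 using hex
  have := Finset.card_le_card_of_injOn (s := Finset.univ) (t := Finset.Ico s M)
    (fun i => (f (g i)).1) (fun i _ => by simpa using hg2 i) (by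
      intro i _ j _ hij
      have : g i = g j := hf (Fin.ext hij)
      apply Fin.ext
      rw [← hg1 i, ← hg1 j, this])
  simp at this
  omega

theorem mainTheorem5 {V : Type*} [Fintype V] (T : SimpleGraph V) [DecidableRel T.Adj]
    (n k : ℕ) (hT : T.IsTree) (hV : Fintype.card V = n) (hΔ : T.maxDegree < n - k)
    (hk : 2 ≤ k) (hn : 3424 * k ^ 4 ≤ n) :
    graphRamseyNumber T (SimpleGraph.pathGraph k) = n + k / 2 - 1 := by
  have hkn : k < n := by omega
  have hmem : n + k / 2 - 1 ∈ {N : ℕ | 0 < N ∧ ∀ G : SimpleGraph (Fin N),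
      T.IsContained G ∨ (pathGraph k).IsContained Gᶜ} := by
    refine ⟨by omega, fun G => or_iff_not_imp_right.2 fun hG => ?_⟩
    obtain ⟨d, rfl⟩ : ∃ d, k = d + 2 := ⟨k - 2, by omega⟩
    have hdeg : ∀ c, (nbrs T c).card + (d + 2) + 1 ≤ n := by
      intro c
      have h1 := T.degree_le_maxDegree c
      have h2 : T.degree c = (nbrs T c).card := by
        rw [← card_neighborFinset_eq_degree]
        congr 1
        ext; simp
      omega
    -- The lemma is applied with `H` the complement of `G`.
    have := hT.isContained_compl (pathsShorter_of_not_isContained hG) (m := (d + 2) / 2 - 1)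
      (by omega) (by omega) hV (by rw [Fintype.card_fin]; omega) hn hdeg
    rwa [compl_compl] at this
  refine le_antisymm (Nat.sInf_le hmem) (le_csInf ⟨_, hmem⟩ ?_)
  rintro M ⟨hM, h⟩
  by_contra! hlt
  rcases h (twoCliques M (n - 1)) with h | h
  · exact not_isContained_twoCliques hT.connected (by omega) (by omega) h
  · exact not_pathGraph_isContained_compl_twoCliques (by omega) h
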